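/- All directed graphs are finite and have no loops, and $\log$ is the logarithm in base $2$. Let $H$ be a directed acyclic graph with at least two edges and no isolated vertices that is not a rooted star (a rooted star is a star whose center is a source or a sink). Let $$a(H)=\max_{H'}\frac{|E(H')|}{|V(H')|-1},$$ where the maximum is over all subgraphs $H'$ of $H$ with at least two vertices. For a directed graph $G$ on the vertex set $[n]$ and a permutation $\pi$ of $[n]$, let $G_L(\pi)$ be the spanning acyclic subgraph of $G$ consisting of all edges $(i,j)$ of $G$ with $\pi(i)<\pi(j)$. Let $\tau(H,G)$ be the smallest integer $t$ for which there are permutations $\pi_1,\ldots,\pi_t$ of $[n]$ such that every subgraph of $G$ isomorphic to $H$ is a subgraph of $G_L(\pi_i)$ for at least one $i$. Let $\vec G(n,p)$ be the random directed graph on $[n]$ in which each of the $n(n-1)$ ordered pairs of distinct vertices is an edge independently with probability $p$. Then for every real $a^*>a(H)$ there is a constant $c^*=c^*(a^*,H)>0$ such that the probability that $G\sim\vec G(n,n^{-1/a^*})$ satisfies $\tau(H,G)\ge c^*\log n$ tends to $1$ as $n\to\infty$. In particular, there is also a constant $C>0$ such that the probability that $c^*\log n\le\tau(H,G)\le C\log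 n$ tends to $1$ as $n\to\infty$ (that is, asymptotically almost surely $\tau(H,G)=\Theta(\log n)$). -/

import Mathlib

namespace DagCover

open Filter Topology ProbabilityTheory

/-- A directed graph is acyclic if no vertex can be reached from itself by a directed walk of
positive length. In particular, it has no loops and no pairs of opposite edges. -/
def IsDag {V : Type*} (H : Digraph V) : Prop :=
  ∀ v : V, ¬ Relation.TransGen H.Adj v v

/-- A rooted star: a vertex `c` is joined to all other vertices, all edges contain `c`, and
`c` is either a source or a sink. -/
def IsRootedStar {V : Type*} (H : Digraph V) : Prop :=
  ∃ c : V, (∀ u v : V, H.Adj u v ↔ u = c ∧ v ≠ c) ∨ (∀ u v : V, H.Adj u v ↔ v = c ∧ u ≠ c)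

/-- Every vertex is incident with an edge. -/
def NoIsolatedVertices {V : Type*} (H : Digraph V) : Prop :=
  ∀ v : V, ∃ u : V, H.Adj u v ∨ H.Adj v u

/-- `S` and `E` are the vertex set and the edge set of a subgraph of `H`. -/
def IsSubgraphPair {V : Type*} (H : Digraph V) (S : Finset V) (E : Finset (V × V)) : Prop :=
  ∀ e ∈ E, e.1 ∈ S ∧ e.2 ∈ S ∧ H.Adj e.1 e.2

/-- The fractional arboricity: the maximum of `|E(H')| / (|V(H')| - 1)` over all subgraphs `H'`
of `H` with at least two vertices (a supremum over a finite set of values). -/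
noncomputable def fractionalArboricity {V : Type*} (H : Digraph V) : ℝ :=
  sSup {x : ℝ | ∃ (S : Finset V) (E : Finset (V × V)),
    2 ≤ S.card ∧ IsSubgraphPair H S E ∧ x = (E.card : ℝ) / ((S.card : ℝ) - 1)}

/-- A labeled `H`-copy of `G`: an injective map of the vertices that sends edges to edges.
The `H`-copies of `G`, that is, the subgraphs of `G` isomorphic to `H`, are exactly the images of
such maps. -/
def IsCopy {V W : Type*} (H : Digraph V) (G : Digraph W) (f : V → W) : Prop :=
  Function.Injective f ∧ ∀ u v : V, H.Adj u v → G.Adj (f u) (f v)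

/-- The spanning subgraph of `G` of the edges `(i, j)` with `π i < π j`. -/
def leftGraph {n : ℕ} (G : Digraph (Fin n)) (π : Equiv.Perm (Fin n)) : Digraph (Fin n) where
  Adj i j := G.Adj i j ∧ π i < π j

/-- A family of permutations covers all `H`-copies of `G` if every `H`-copy of `G` is a subgraph
of `leftGraph G (π i)` for at least one index `i`. -/
def CoversAllCopies {V : Type*} {n t : ℕ} (H : Digraph V) (G : Digraph (Fin n))
    (π : Fin t → Equiv.Perm (Fin n)) : Prop :=
  ∀ f : V → Fin n, IsCopy H G f →
    ∃ i : Fin t, ∀ u v : V, H.Adj u v → (leftGraph G (π i)).Adj (f u) (f v)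

/-- The covering number `τ(H, G)`: the smallest `t` such that some `t` permutations cover all
`H`-copies of `G`. -/
noncomputable def tau {V : Type*} {n : ℕ} (H : Digraph V) (G : Digraph (Fin n)) : ℕ :=
  sInf {t : ℕ | ∃ π : Fin t → Equiv.Perm (Fin n), CoversAllCopies H G π}

/-- The directed graph with a given set of edges. -/
def ofEdgeSet {W : Type*} (E : Set (W × W)) : Digraph W where
  Adj i j := (i, j) ∈ E

/-- The probability that a random directed graph on `Fin n`, in which each ordered pair of
distinct vertices is independently an edge with probability `p`, has the property `P`. -/
noncomputable def randomDigraphProb (n : ℕ) (p : unitInterval) (P : Digraph (Fin n) → Prop) : ENNReal :=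
  setBer({e : Fin n × Fin n | e.1 ≠ e.2}, p) {E | P (ofEdgeSet E)}

/-- The property `P` holds asymptotically almost surely in the random directed graph with edge
probability `p n`. -/
def AlmostSurely (p : ℕ → unitInterval) (P : ∀ n : ℕ, Digraph (Fin n) → Prop) : Prop :=
  Tendsto (fun n : ℕ => randomDigraphProb n (p n) (P n)) atTop (𝓝 1)

/-- The edge probability `n ^ (-1 / a)` as an element of the unit interval. No truncation takes
place if `a` is positive, see `coe_edgeProb`. -/
noncomputable def edgeProb (a : ℝ) (n : ℕ) : unitInterval :=
  Set.projIcc 0 1 zero_le_one ((n : ℝ) ^ (-1 / a))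

theorem coe_edgeProb {a : ℝ} (ha : 0 < a) (n : ℕ) : (edgeProb a n : ℝ) = (n : ℝ) ^ (-1 / a) := by
  have hneg : -1 / a < 0 := div_neg_of_neg_of_pos (by norm_num) ha
  have hmem : (n : ℝ) ^ (-1 / a) ∈ Set.Icc (0 : ℝ) 1 := by
    refine ⟨by positivity, ?_⟩
    rcases Nat.eq_zero_or_pos n with rfl | hn
    · simp [Real.zero_rpow hneg.ne]
    · exact Real.rpow_le_one_of_one_le_of_nonpos (by exact_mod_cast hn) hneg.le
  simp [edgeProb, Set.projIcc_of_mem zero_le_one hmem]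

end DagCover

/-! Write `h` for the number of vertices of `H`, `δ = 1 - a(H)/a` and `K = (h+1)^h`. The lower bound
is a union bound over all families of `t ≤ (δ/4) log n` permutations, of which there are `(n!)^t =
exp(O(n log² n))`. Each family must therefore fail to cover with probability `1 - exp(-n^(1+ε))` for
some `ε > 0`.

Many uncovered maps: as `H` is not a rooted star, it has edges `u → v` and `z → w` with distinct
tails and distinct heads. Record for each pair `(x, y)` the set of permutations with `π x < π y`. If
`(f u, f v)` and `(f w, f z)` have the same record, then no permutation directs both edges to the
right. There are `2^t ≤ n^(δ/4)` records, so by Cauchy-Schwarz a fraction `n^(-δ/4)` of all maps has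
this coincidence, and few of them fail to be injective (`pow_le_two_pow_mul_card_uncovered`).

Random part: a covering family means that `G` contains no uncovered copy. Janson's inequality bounds
this probability. Since `a > a(H)`, a subgraph with `s ≥ 2` vertices and `e` edges has `n^s p^e ≥
n^(1+δ)`, so correlations of overlapping copies are small, and the bound is `exp(-n^(1+δ/2)/(16K))`
(`randomDigraphProb_covers_le`), which beats the union bound.

The upper bound is deterministic: a random permutation covers a given injective map with probability
at least `1/h!`, so greedy choices cover everything after `O(log n)` steps
(`exists_coversAllCopies`). -/

namespace DagCover

open Filter Topology ProbabilityTheory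

/-! ### Random subsets of a finite set: independence and Harris' inequality -/

section Bernoulli

set_option linter.unusedSectionVars false

variable {α : Type*} [Fintype α] [DecidableEq α]

/-- The probability that the random subset of `u`, in which each element is kept independently
with probability `p`, equals `S`. -/
noncomputable def bernWeight (u : Finset α) (p : ℝ) (S : Finset α) : ℝ :=
  if S ⊆ u then p ^ S.card * (1 - p) ^ (u \ S).card else 0

/-- The expectation of `g` over the random subset of `u`. -/
noncomputable def bernExp (u : Finset α) (p : ℝ) (g : Finset α → ℝ) : ℝ :=
  ∑ S, bernWeight u p S * g S

theorem bernWeight_nonneg (u : Finset α) {p : ℝ} (hp0 : 0 ≤ p) (hp1 : p ≤ 1) (S : Finset α) :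
    0 ≤ bernWeight u p S := by
  unfold bernWeight
  have : 0 ≤ 1 - p := by linarith
  split_ifs <;> positivity

theorem sum_bernWeight (u : Finset α) (p : ℝ) : ∑ S, bernWeight u p S = 1 := by
  have h := Finset.sum_pow_mul_eq_add_pow p (1 - p) u
  rw [add_sub_cancel, one_pow] at h
  rw [← h]
  unfold bernWeight
  rw [← Finset.sum_filter]
  refine Finset.sum_congr (by ext; simp) fun S hS => ?_
  rw [Finset.card_sdiff_of_subset (Finset.mem_powerset.1 hS)]

theorem bernExp_mono {u : Finset α} {p : ℝ} (hp0 : 0 ≤ p) (hp1 : p ≤ 1) {f g : Finset α → ℝ}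
    (h : ∀ S, f S ≤ g S) : bernExp u p f ≤ bernExp u p g :=
  Finset.sum_le_sum fun S _ => mul_le_mul_of_nonneg_left (h S) (bernWeight_nonneg u hp0 hp1 S)

theorem bernExp_nonneg {u : Finset α} {p : ℝ} (hp0 : 0 ≤ p) (hp1 : p ≤ 1) {f : Finset α → ℝ}
    (h : ∀ S, 0 ≤ f S) : 0 ≤ bernExp u p f :=
  Finset.sum_nonneg fun S _ => mul_nonneg (bernWeight_nonneg u hp0 hp1 S) (h S)

theorem bernExp_sub (u : Finset α) (p : ℝ) (f g : Finset α → ℝ) :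
    bernExp u p (fun S => f S - g S) = bernExp u p f - bernExp u p g := by
  simp [bernExp, mul_sub]

theorem bernExp_sum {ι : Type*} (s : Finset ι) (u : Finset α) (p : ℝ) (f : ι → Finset α → ℝ) :
    bernExp u p (fun S => ∑ i ∈ s, f i S) = ∑ i ∈ s, bernExp u p (f i) := by
  simp only [bernExp, Finset.mul_sum]
  exact Finset.sum_comm

theorem bernExp_const (u : Finset α) (p c : ℝ) : bernExp u p (fun _ => c) = c := by
  simp [bernExp, ← Finset.sum_mul, sum_bernWeight]

theorem bernExp_mul_const (u : Finset α) (p c : ℝ) (f : Finset α → ℝ) :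
    bernExp u p (fun S => f S * c) = bernExp u p f * c := by
  simp [bernExp, Finset.sum_mul, mul_assoc]

theorem exists_bernExp_le {u : Finset α} {p : ℝ} (hp0 : 0 ≤ p) (hp1 : p ≤ 1)
    (f : Finset α → ℝ) : ∃ S ⊆ u, bernExp u p f ≤ f S := by
  by_contra! h
  have hlt : bernExp u p f < bernExp u p (fun _ => bernExp u p f) := by
    have hex : ∃ S ∈ Finset.univ, bernWeight u p S ≠ 0 := by
      by_contra! h0
      have := sum_bernWeight u p
      rw [Finset.sum_eq_zero h0] at this
      norm_num at this
    have hle : ∀ S, bernWeight u p S * f S ≤ bernWeight u p S * bernExp u p f := by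
      intro S
      by_cases hS : S ⊆ u
      · exact mul_le_mul_of_nonneg_left (h S hS).le (bernWeight_nonneg u hp0 hp1 S)
      · simp [bernWeight, hS]
    obtain ⟨S, _, hS⟩ := hex
    refine Finset.sum_lt_sum (fun S _ => hle S) ⟨S, Finset.mem_univ _, ?_⟩
    have hSu : S ⊆ u := by
      by_contra hc
      exact hS (by simp [bernWeight, hc])
    exact mul_lt_mul_of_pos_left (h S hSu)
      (lt_of_le_of_ne (bernWeight_nonneg u hp0 hp1 S) (Ne.symm hS))
  rw [bernExp_const] at hlt
  exact lt_irrefl _ hlt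

/-- The ratio `p : (1 - p)` of the two weights is cleared of denominators, so that `p = 1` is
allowed. -/
theorem bernWeight_insert {u : Finset α} {p : ℝ} {e : α} (he : e ∈ u) {S : Finset α}
    (hS : e ∉ S) : bernWeight u p (insert e S) * (1 - p) = bernWeight u p S * p := by
  unfold bernWeight
  by_cases h : S ⊆ u
  · have h' : insert e S ⊆ u := Finset.insert_subset he h
    have hs : u \ S = insert e (u \ insert e S) := by
      ext x; simp only [Finset.mem_sdiff, Finset.mem_insert]; grind
    rw [if_pos h, if_pos h', Finset.card_insert_of_notMem hS, hs,
      Finset.card_insert_of_notMem (by simp)]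
    ring
  · have h' : ¬ insert e S ⊆ u := fun hc => h ((Finset.subset_insert _ _).trans hc)
    simp [h, h']

theorem bernExp_mem_mul {u : Finset α} {p : ℝ} {e : α} (he : e ∈ u) {g : Finset α → ℝ}
    (hg : ∀ S, g (insert e S) = g S) :
    bernExp u p (fun S => (if e ∈ S then 1 else 0) * g S) = p * bernExp u p g := by
  have key : ∀ f : Finset α → ℝ, ∑ S, f S =
      ∑ S ∈ (Finset.univ.erase e).powerset, (f S + f (insert e S)) := by
    intro f
    have h := Finset.sum_powerset_insert (Finset.notMem_erase e Finset.univ) f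
    rw [Finset.insert_erase (Finset.mem_univ e), Finset.powerset_univ] at h
    rw [h, Finset.sum_add_distrib]
  unfold bernExp
  rw [key, key, Finset.mul_sum]
  refine Finset.sum_congr rfl fun S hS => ?_
  have heS : e ∉ S := fun h => Finset.notMem_erase e _ (Finset.mem_powerset.1 hS h)
  have := bernWeight_insert (p := p) he heS
  simp only [heS, if_false, Finset.mem_insert_self, if_true, hg]
  linear_combination (g S) * this

/-- Independence of `A ⊆ S` from functions of `S \ A`. -/
theorem bernExp_subset_mul {u : Finset α} {p : ℝ} {A : Finset α} (hA : A ⊆ u) {g : Finset α → ℝ}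
    (hg : ∀ e ∈ A, ∀ S, g (insert e S) = g S) :
    bernExp u p (fun S => (if A ⊆ S then 1 else 0) * g S) = p ^ A.card * bernExp u p g := by
  induction A using Finset.induction_on with
  | empty => simp
  | insert e A heA ih =>
    have h1 : ∀ S : Finset α, (if insert e A ⊆ S then (1 : ℝ) else 0) * g S =
        (if e ∈ S then 1 else 0) * ((if A ⊆ S then 1 else 0) * g S) := by
      intro S
      by_cases h1 : e ∈ S <;> by_cases h2 : A ⊆ S <;> simp [Finset.insert_subset_iff, h1, h2]
    simp only [h1]
    rw [bernExp_mem_mul (hA (Finset.mem_insert_self _ _)),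
      ih ((Finset.subset_insert _ _).trans hA) (fun x hx => hg x (Finset.mem_insert_of_mem hx)),
      Finset.card_insert_of_notMem heA]
    · ring
    · intro S
      have : A ⊆ insert e S ↔ A ⊆ S := Finset.subset_insert_iff_of_notMem heA
      simp only [this, hg e (Finset.mem_insert_self _ _)]

theorem bernExp_subset {u : Finset α} {p : ℝ} {A : Finset α} (hA : A ⊆ u) :
    bernExp u p (fun S => if A ⊆ S then 1 else 0) = p ^ A.card := by
  have := bernExp_subset_mul (p := p) hA (g := fun _ => 1) (by simp)
  simpa [bernExp_const] using this

/-- The log-supermodularity required by the FKG inequality; for subsets of `u` it is an equality,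
since a product measure has modular log-weights. -/
theorem bernWeight_mul_le {u : Finset α} {p : ℝ} (hp0 : 0 ≤ p) (hp1 : p ≤ 1) (S T : Finset α) :
    bernWeight u p S * bernWeight u p T ≤ bernWeight u p (S ∩ T) * bernWeight u p (S ∪ T) := by
  by_cases h : S ⊆ u ∧ T ⊆ u
  · obtain ⟨hS, hT⟩ := h
    unfold bernWeight
    rw [if_pos hS, if_pos hT, if_pos (Finset.inter_subset_left.trans hS),
      if_pos (Finset.union_subset hS hT)]
    apply le_of_eq
    have h1 := Finset.card_inter_add_card_union S T
    have h2 := Finset.card_inter_add_card_union (u \ S) (u \ T)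
    rw [← Finset.sdiff_union_distrib, ← Finset.sdiff_inter_distrib_right] at h2
    calc _ = p ^ (S.card + T.card) * (1 - p) ^ ((u \ S).card + (u \ T).card) := by ring
      _ = _ := by rw [← h1, ← h2]; ring
  · have h0 : bernWeight u p S * bernWeight u p T = 0 := by
      unfold bernWeight
      rcases not_and_or.1 h with h | h <;> simp [h]
    rw [h0]
    exact mul_nonneg (bernWeight_nonneg u hp0 hp1 _) (bernWeight_nonneg u hp0 hp1 _)

/-- Harris' inequality for an increasing and a decreasing function. -/
theorem bernExp_mul_le {u : Finset α} {p : ℝ} (hp0 : 0 ≤ p) (hp1 : p ≤ 1) {f g : Finset α → ℝ}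
    (hf : Monotone f) (hg : Antitone g) (hf0 : ∀ S, 0 ≤ f S) (hg1 : ∀ S, g S ≤ 1) :
    bernExp u p (fun S => f S * g S) ≤ bernExp u p f * bernExp u p g := by
  have h := fkg (μ := bernWeight u p) (f := f) (g := fun S => 1 - g S)
    (bernWeight_nonneg u hp0 hp1) hf0 (fun S => sub_nonneg.2 (hg1 S)) hf
    (fun S T hST => sub_le_sub_left (hg hST) 1) (bernWeight_mul_le hp0 hp1)
  rw [sum_bernWeight, one_mul] at h
  change bernExp u p f * bernExp u p (fun S => 1 - g S) ≤
    bernExp u p (fun S => f S * (1 - g S)) at h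
  have e : (fun S => f S * (1 - g S)) = fun S => f S - f S * g S := by ext; ring
  rw [e, bernExp_sub, bernExp_sub, bernExp_const] at h
  linarith

/-! ### Janson's inequality -/

section Janson

variable {ι : Type*} [DecidableEq ι]

/-- The indicator of the event that the random set contains no member of a family. -/
noncomputable def noneInd (A : ι → Finset α) (s : Finset ι) (S : Finset α) : ℝ :=
  if ∀ j ∈ s, ¬ A j ⊆ S then 1 else 0

theorem noneInd_nonneg (A : ι → Finset α) (s : Finset ι) (S : Finset α) :
    0 ≤ noneInd A s S := by
  unfold noneInd; split_ifs <;> norm_num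

theorem noneInd_le_one (A : ι → Finset α) (s : Finset ι) (S : Finset α) :
    noneInd A s S ≤ 1 := by
  unfold noneInd; split_ifs <;> norm_num

theorem noneInd_anti (A : ι → Finset α) (S : Finset α) {s t : Finset ι} (h : s ⊆ t) :
    noneInd A t S ≤ noneInd A s S := by
  unfold noneInd
  split_ifs with h1 h2 h2
  · exact le_rfl
  · exact absurd (fun j hj => h1 j (h hj)) h2
  · norm_num
  · exact le_rfl

theorem noneInd_antitone (A : ι → Finset α) (s : Finset ι) : Antitone (noneInd A s) := by
  intro S T hST
  unfold noneInd
  split_ifs with h1 h2 h2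
  · exact le_rfl
  · exact absurd (fun j hj hc => h1 j hj (hc.trans hST)) h2
  · norm_num
  · exact le_rfl

/-- The joint probability of two distinct dependent members of a family. -/
noncomputable def jointProb (A : ι → Finset α) (p : ℝ) (i j : ι) : ℝ :=
  if i ≠ j ∧ ¬ Disjoint (A i) (A j) then p ^ (A i ∪ A j).card else 0

theorem jointProb_nonneg (A : ι → Finset α) {p : ℝ} (hp0 : 0 ≤ p) (i j : ι) :
    0 ≤ jointProb A p i j := by
  unfold jointProb; split_ifs <;> positivity

/-- Split `s` into the members `N` disjoint from `A i` and the others `D`. Adding `i` removes the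
event that `A i` occurs and nothing in `s` does. Its probability is at least that of `A i` without
`N`, minus, for each `j` in `D`, that of `A i ∪ A j` without `N`. Independence evaluates the first
term and Harris' inequality bounds the others, all as multiples of the probability of avoiding `N`.
-/
theorem bernExp_noneInd_insert {u : Finset α} {p : ℝ} (hp0 : 0 ≤ p) (hp1 : p ≤ 1)
    {A : ι → Finset α} {s : Finset ι} {i : ι} (hi : i ∉ s) (hA : ∀ j ∈ insert i s, A j ⊆ u) :
   
    bernExp u p (noneInd A (insert i s)) ≤
      Real.exp (-(p ^ (A i).card - ∑ j ∈ s, jointProb A p i j)) * bernExp u p (noneInd A s) := by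
  have hAi : A i ⊆ u := hA i (Finset.mem_insert_self _ _)
  set N := s.filter fun j => Disjoint (A i) (A j) with hN
  set D := s.filter fun j => ¬ Disjoint (A i) (A j) with hD
  set x := p ^ (A i).card - ∑ j ∈ s, jointProb A p i j with hx
  have hNs : bernExp u p (noneInd A s) ≤ bernExp u p (noneInd A N) :=
    bernExp_mono hp0 hp1 fun S => noneInd_anti A S (Finset.filter_subset _ _)
  have hpw : ∀ S, noneInd A (insert i s) S ≤ noneInd A s S -
      ((if A i ⊆ S then 1 else 0) * noneInd A N S -
        ∑ j ∈ D, (if A i ∪ A j ⊆ S then 1 else 0) * noneInd A N S) := by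
    intro S
    have hsum : 0 ≤ ∑ j ∈ D, (if A i ∪ A j ⊆ S then (1 : ℝ) else 0) * noneInd A N S :=
      Finset.sum_nonneg fun j _ => mul_nonneg (by split_ifs <;> norm_num) (noneInd_nonneg _ _ _)
    by_cases h1 : A i ⊆ S
    · have h0 : noneInd A (insert i s) S = 0 := by
        unfold noneInd
        rw [if_neg]
        intro h
        exact h i (Finset.mem_insert_self _ _) h1
      rw [h0, if_pos h1, one_mul]
      by_cases h2 : ∀ j ∈ N, ¬ A j ⊆ S
      · have hN1 : noneInd A N S = 1 := if_pos h2
        by_cases h3 : ∀ j ∈ s, ¬ A j ⊆ S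
        · have : noneInd A s S = 1 := if_pos h3
          linarith
        · push Not at h3
          obtain ⟨j, hj, hjS⟩ := h3
          have hjD : j ∈ D := by
            rw [hD, Finset.mem_filter]
            refine ⟨hj, fun hd => h2 j ?_ hjS⟩
            rw [hN, Finset.mem_filter]
            exact ⟨hj, hd⟩
          have h4 := Finset.single_le_sum (s := D)
            (f := fun j => (if A i ∪ A j ⊆ S then (1 : ℝ) else 0) * noneInd A N S)
            (fun j _ => mul_nonneg (by split_ifs <;> norm_num) (noneInd_nonneg _ _ _)) hjD
          simp only [if_pos (Finset.union_subset h1 hjS), one_mul] at h4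
          have := noneInd_nonneg A s S
          linarith
      · have hN0 : noneInd A N S = 0 := if_neg h2
        have := noneInd_nonneg A s S
        linarith
    · have h4 : noneInd A (insert i s) S ≤ noneInd A s S :=
        noneInd_anti A S (Finset.subset_insert _ _)
      rw [if_neg h1, zero_mul]
      linarith
  have hE := bernExp_mono (u := u) hp0 hp1 hpw
  rw [bernExp_sub, bernExp_sub, bernExp_sum, bernExp_subset_mul hAi] at hE
  · have hDle : ∑ j ∈ D, bernExp u p
        (fun S => (if A i ∪ A j ⊆ S then 1 else 0) * noneInd A N S) ≤
        (∑ j ∈ s, jointProb A p i j) * bernExp u p (noneInd A N) := by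
      rw [← Finset.sum_filter_add_sum_filter_not s (fun j => Disjoint (A i) (A j)), add_mul,
        Finset.sum_mul, Finset.sum_mul]
      refine le_add_of_nonneg_of_le (Finset.sum_nonneg fun j _ => mul_nonneg
        (jointProb_nonneg A hp0 i j) (bernExp_nonneg hp0 hp1 (noneInd_nonneg A N))) ?_
      refine Finset.sum_le_sum fun j hj => ?_
      obtain ⟨hjs, hjd⟩ := Finset.mem_filter.1 hj
      have hij : i ≠ j := fun h => hi (h ▸ hjs)
      rw [jointProb, if_pos ⟨hij, hjd⟩, ← bernExp_subset (Finset.union_subset hAi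
        (hA j (Finset.mem_insert_of_mem hjs)))]
      refine bernExp_mul_le hp0 hp1 ?_ (noneInd_antitone A N) ?_ (noneInd_le_one A N)
      · intro S T hST
        dsimp only
        split_ifs with h1 h2 h2
        · exact le_rfl
        · exact absurd (h1.trans hST) h2
        · norm_num
        · exact le_rfl
      · intro S
        split_ifs <;> norm_num
    have hE' : bernExp u p (noneInd A (insert i s)) ≤
        bernExp u p (noneInd A s) - x * bernExp u p (noneInd A N) := by
      rw [hx, sub_mul]
      have e : bernExp u p (fun S => noneInd A s S) = bernExp u p (noneInd A s) := rfl
      linarith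
    have hs0 : 0 ≤ bernExp u p (noneInd A s) := bernExp_nonneg hp0 hp1 (noneInd_nonneg A s)
    -- For `x ≥ 0`, avoiding `N` may be replaced by the less likely event of avoiding `s`; for `x <
    -- 0` the exponential exceeds 1 and monotonicity suffices.
    rcases le_or_gt 0 x with h | h
    · have h5 := mul_le_mul_of_nonneg_left hNs h
      have h6 := mul_le_mul_of_nonneg_right (Real.add_one_le_exp (-x)) hs0
      linarith
    · have h5 : bernExp u p (noneInd A (insert i s)) ≤ bernExp u p (noneInd A s) :=
        bernExp_mono hp0 hp1 fun S => noneInd_anti A S (Finset.subset_insert _ _)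
      have h6 : (1 : ℝ) ≤ Real.exp (-x) := Real.one_le_exp (by linarith)
      have h7 := mul_le_mul_of_nonneg_right h6 hs0
      linarith
  · intro e he S
    have hiff : ∀ j ∈ N, (A j ⊆ insert e S ↔ A j ⊆ S) := by
      intro j hj
      refine Finset.subset_insert_iff_of_notMem ?_
      exact Finset.disjoint_left.1 (Finset.mem_filter.1 hj).2 he
    unfold noneInd
    congr 1
    refine propext (forall₂_congr fun j hj => ?_)
    rw [hiff j hj]

/-- The inequality of Boppana and Spencer. -/
theorem bernExp_noneInd_le {u : Finset α} {p : ℝ} (hp0 : 0 ≤ p) (hp1 : p ≤ 1)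
    {A : ι → Finset α} (s : Finset ι) (hA : ∀ j ∈ s, A j ⊆ u) :
    bernExp u p (noneInd A s) ≤
      Real.exp (-(∑ i ∈ s, p ^ (A i).card - ∑ i ∈ s, ∑ j ∈ s, jointProb A p i j)) := by
  induction s using Finset.induction_on with
  | empty =>
    simp only [Finset.sum_empty, sub_zero, neg_zero, Real.exp_zero]
    refine (bernExp_mono hp0 hp1 (noneInd_le_one A ∅)).trans ?_
    rw [bernExp_const]
  | insert i s hi ih =>
    refine (bernExp_noneInd_insert hp0 hp1 hi hA).trans ?_
    refine (mul_le_mul_of_nonneg_left (ih fun j hj => hA j (Finset.mem_insert_of_mem hj)) (Real.exp_pos _).le).trans ?_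
    rw [← Real.exp_add, Real.exp_le_exp]
    -- Each pair is needed in one order only; the terms `(i, i)` and `(j, i)` are nonnegative and
    -- are added to make the double sum symmetric.
    simp only [Finset.sum_insert hi, Finset.sum_add_distrib]
    have h1 := jointProb_nonneg A hp0 i i
    have h2 : 0 ≤ ∑ j ∈ s, jointProb A p j i :=
      Finset.sum_nonneg fun j _ => jointProb_nonneg A hp0 j i
    linarith

/-- Janson's inequality, with a free parameter `q`. -/
theorem bernExp_noneInd_le_of_thinning [Fintype ι] {u : Finset α} {p q : ℝ} (hp0 : 0 ≤ p)
    (hp1 : p ≤ 1) (hq0 : 0 ≤ q) (hq1 : q ≤ 1) {A : ι → Finset α} (s : Finset ι)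
    (hA : ∀ j ∈ s, A j ⊆ u) :
    bernExp u p (noneInd A s) ≤
      Real.exp (-(q * ∑ i ∈ s, p ^ (A i).card -
        q ^ 2 * ∑ i ∈ s, ∑ j ∈ s, jointProb A p i j)) := by
  -- Keep each member of the family with probability `q`: single terms survive with probability `q`,
  -- pairs with `q ^ 2`. Some subfamily `T` is at least as good as the average, and the previous
  -- inequality is applied to it.
  obtain ⟨T, hTs, hT⟩ := exists_bernExp_le (u := s) hq0 hq1
    (fun T => ∑ i ∈ s, (if {i} ⊆ T then 1 else 0) * p ^ (A i).card -
      ∑ i ∈ s, ∑ j ∈ s, (if {i, j} ⊆ T then 1 else 0) * jointProb A p i j)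
  refine (bernExp_mono hp0 hp1 fun S => noneInd_anti A S hTs).trans ?_
  refine (bernExp_noneInd_le hp0 hp1 T fun j hj => hA j (hTs hj)).trans ?_
  rw [Real.exp_le_exp, neg_le_neg_iff]
  have h1 : ∑ i ∈ s, (if {i} ⊆ T then (1 : ℝ) else 0) * p ^ (A i).card =
      ∑ i ∈ T, p ^ (A i).card := by
    simp only [Finset.singleton_subset_iff, ite_mul, one_mul, zero_mul]
    rw [← Finset.sum_filter, Finset.filter_mem_eq_inter, Finset.inter_eq_right.2 hTs]
  have h2 : ∑ i ∈ s, ∑ j ∈ s, (if {i, j} ⊆ T then (1 : ℝ) else 0) * jointProb A p i j =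
      ∑ i ∈ T, ∑ j ∈ T, jointProb A p i j := by
    simp only [Finset.insert_subset_iff, Finset.singleton_subset_iff, ite_mul, one_mul, zero_mul]
    rw [← Finset.sum_subset hTs]
    · refine Finset.sum_congr rfl fun i hi => ?_
      rw [← Finset.sum_subset hTs]
      · refine Finset.sum_congr rfl fun j hj => by rw [if_pos ⟨hi, hj⟩]
      · intro j _ hj
        rw [if_neg fun h => hj h.2]
    · intro i _ hi
      exact Finset.sum_eq_zero fun j _ => by rw [if_neg fun h => hi h.1]
  rw [h1, h2] at hT
  refine le_trans ?_ hT
  rw [bernExp_sub, bernExp_sum, bernExp_sum, Finset.mul_sum, Finset.mul_sum]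
  refine sub_le_sub (Finset.sum_le_sum fun i hi => ?_) (Finset.sum_le_sum fun i hi => ?_)
  · rw [bernExp_mul_const, bernExp_subset (by simpa using hi)]
    simp
  · rw [bernExp_sum, Finset.mul_sum]
    refine Finset.sum_le_sum fun j hj => ?_
    rw [bernExp_mul_const, bernExp_subset (by simp [Finset.insert_subset_iff, hi, hj])]
    by_cases hij : i = j
    · simp [jointProb, hij]
    · rw [Finset.card_pair hij]

end Janson

open Classical in
theorem setBernoulli_eq_bernExp (u : Finset α) (p : unitInterval) (Q : Set α → Prop) :
    setBer((u : Set α), p) {E | Q E} =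
      ENNReal.ofReal (bernExp u p fun S => if Q S then 1 else 0) := by
  rw [← ENNReal.ofReal_toReal (a := setBer((u : Set α), p) _) (by simp),
    ← MeasureTheory.measureReal_def]
  congr 1
  have hset : {E : Set α | Q E} =
      ⋃ S ∈ (Finset.univ.filter fun S : Finset α => Q S), {(S : Set α)} := by
    ext E
    simp only [Set.mem_ofPred_eq, Set.mem_iUnion, Finset.mem_filter, Finset.mem_univ, true_and,
      Set.mem_singleton_iff, exists_prop]
    refine ⟨fun h => ⟨E.toFinset, by simpa using h, by simp⟩, ?_⟩
    rintro ⟨S, h, rfl⟩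
    exact h
  rw [hset, MeasureTheory.measureReal_biUnion_finset]
  · unfold bernExp
    simp only [mul_ite, mul_one, mul_zero]
    rw [← Finset.sum_filter]
    refine Finset.sum_congr rfl fun S _ => ?_
    unfold bernWeight
    split_ifs with h
    · rw [setBernoulli_real_singleton p (by exact_mod_cast h) u.finite_toSet, ← Finset.coe_sdiff,
        Set.ncard_coe_finset, Set.ncard_coe_finset]
    · rw [MeasureTheory.measureReal_def,
        setBernoulli_singleton_of_not_subset p (by exact_mod_cast h)]
      simp
  · intro S _ T _ hST
    simpa [Function.onFun] using hST
  · intro S _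
    exact MeasurableSet.singleton _

end Bernoulli

/-! ### Two edges of a non-star, and coincidences of records -/

section Counting

set_option linter.unusedSectionVars false

/-- A directed acyclic graph that is not a rooted star has two edges with distinct tails and
distinct heads; if they meet, the first one precedes the second one. -/
theorem exists_two_edges {V : Type*} [Finite V] {H : Digraph V} (hdag : IsDag H)
    (hiso : NoIsolatedVertices H) (hedges : 2 ≤ {e : V × V | H.Adj e.1 e.2}.ncard)
    (hstar : ¬ IsRootedStar H) :
    ∃ u v z w, H.Adj u v ∧ H.Adj z w ∧ u ≠ v ∧ u ≠ z ∧ u ≠ w ∧ v ≠ w ∧ z ≠ w := by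
  have hloop : ∀ {a b}, H.Adj a b → a ≠ b := by
    rintro a b h rfl
    exact hdag a (.single h)
  by_cases hex : ∃ u v z w, H.Adj u v ∧ H.Adj z w ∧ u ≠ z ∧ v ≠ w
  · obtain ⟨u, v, z, w, h1, h2, huz, hvw⟩ := hex
    -- If the second edge ends where the first begins, the two are exchanged; acyclicity keeps the
    -- outer endpoints distinct.
    by_cases huw : u = w
    · subst huw
      refine ⟨z, u, u, v, h2, h1, hloop h2, huz.symm, ?_, hloop h1, hloop h1⟩
      rintro rfl
      exact hdag u (.tail (.single h1) h2)
    · exact ⟨u, v, z, w, h1, h2, hloop h1, huz, huw, hvw, hloop h2⟩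
  · exfalso
    -- Now edges with different tails have the same head. Two edges with a common tail have
    -- different heads, so no edge has another tail. If the tails differ, the head is common, and an
    -- edge with another head would have both tails. Absence of isolated vertices makes the star
    -- spanning.
    push Not at hex
    obtain ⟨⟨a, b⟩, hab, ⟨c, d⟩, hcd, hne⟩ :=
      Set.one_lt_ncard_iff_nontrivial.1 hedges
    apply hstar
    simp only [Set.mem_ofPred_eq] at hab hcd
    by_cases hac : a = c
    · subst hac
      have hbd : b ≠ d := fun h => hne (by rw [h])
      have hall : ∀ x y, H.Adj x y → x = a := by
        intro x y hxy
        by_contra hx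
        exact hbd ((hex x y a b hxy hab hx).symm.trans (hex x y a d hxy hcd hx))
      refine ⟨a, Or.inl fun x y => ⟨fun h => ?_, ?_⟩⟩
      · obtain rfl := hall x y h
        exact ⟨rfl, (hloop h).symm⟩
      · rintro ⟨rfl, hy⟩
        obtain ⟨k, hk | hk⟩ := hiso y
        · rwa [hall k y hk] at hk
        · exact absurd (hall y k hk) hy
    · obtain rfl : b = d := hex a b c d hab hcd hac
      have hall : ∀ x y, H.Adj x y → y = b := by
        intro x y hxy
        by_contra hy
        have h1 : x = a := by
          by_contra hx
          exact hy (hex x y a b hxy hab hx)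
        have h2 : x = c := by
          by_contra hx
          exact hy (hex x y c b hxy hcd hx)
        exact hac (h1.symm.trans h2)
      refine ⟨b, Or.inr fun x y => ⟨fun h => ?_, ?_⟩⟩
      · obtain rfl := hall x y h
        exact ⟨rfl, hloop h⟩
      · rintro ⟨rfl, hx⟩
        obtain ⟨k, hk | hk⟩ := hiso x
        · exact absurd (hall k x hk) hx
        · rwa [hall x k hk] at hk

/-- By the Cauchy-Schwarz inequality, a map has many pairs with equal values. -/
theorem card_sq_le_card_mul_card_eq {X Y : Type*} [Fintype X] [Fintype Y] [DecidableEq Y]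
    (K : X → Y) :
    Fintype.card X ^ 2 ≤
      Fintype.card Y * (Finset.univ.filter fun a : X × X => K a.1 = K a.2).card := by
  have h1 : Fintype.card X = ∑ y, (Finset.univ.filter fun x => K x = y).card := by
    rw [← Finset.card_univ]
    exact Finset.card_eq_sum_card_fiberwise fun _ _ => Finset.mem_univ _
  have h2 : (Finset.univ.filter fun a : X × X => K a.1 = K a.2).card =
      ∑ y, (Finset.univ.filter fun x => K x = y).card ^ 2 := by
    rw [Finset.card_eq_sum_card_fiberwise (t := Finset.univ) (f := fun a => K a.1)
      fun _ _ => Finset.mem_univ _]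
    refine Finset.sum_congr rfl fun y _ => ?_
    rw [sq, ← Finset.card_product]
    congr 1
    ext ⟨a, b⟩
    simp only [Finset.mem_filter, Finset.mem_univ, true_and, Finset.mem_product]
    constructor
    · rintro ⟨h, rfl⟩
      exact ⟨rfl, h.symm⟩
    · rintro ⟨rfl, h⟩
      exact ⟨h.symm, rfl⟩
  rw [h1, h2]
  have := sq_sum_le_card_mul_sum_sq (s := Finset.univ)
    (f := fun y => (Finset.univ.filter fun x => K x = y).card)
  simpa using this

variable {V β Y : Type*} [Fintype V] [DecidableEq V] [Fintype β] [DecidableEq β] [Fintype Y]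
  [DecidableEq Y]

/-- The pairs of pairs with the same `s`-value, with equal second entries if `e` holds. -/
def equalPairs (s : β → β → Y) (e : Prop) [Decidable e] : Finset ((β × β) × (β × β)) :=
  Finset.univ.filter fun a => s a.1.1 a.1.2 = s a.2.1 a.2.2 ∧ (e → a.1.2 = a.2.2)

/-- If the second entries must agree, Cauchy-Schwarz is applied to the value together with the
second entry, and the extra factor `Fintype.card β` cancels. -/
theorem card_pow_le_card_equalPairs (s : β → β → Y) (e : Prop) [Decidable e] :
    Fintype.card β ^ (if e then 3 else 4) ≤ Fintype.card Y * (equalPairs s e).card := by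
  unfold equalPairs
  split_ifs with he
  · have h := card_sq_le_card_mul_card_eq fun a : β × β => (s a.1 a.2, a.2)
    simp only [Fintype.card_prod, Prod.mk.injEq] at h
    simp only [he, forall_const]
    rcases Nat.eq_zero_or_pos (Fintype.card β) with h0 | h0
    · simp [h0]
    · refine Nat.le_of_mul_le_mul_left ?_ h0
      calc _ = (Fintype.card β * Fintype.card β) ^ 2 := by ring
        _ ≤ _ := h
        _ = _ := by ring
  · have h := card_sq_le_card_mul_card_eq fun a : β × β => s a.1 a.2
    simp only [Fintype.card_prod] at h
    simp only [he, false_imp_iff, and_true]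
    calc _ = (Fintype.card β * Fintype.card β) ^ 2 := by ring
      _ ≤ _ := h

/-- Values at the three or four vertices `u, v, w, z` extend freely to the rest of `V`, so the
proportion of coincidences among maps is at least that among pairs of pairs. -/
theorem card_equalPairs_mul_le (s : β → β → Y) {u v z w : V} (huv : u ≠ v) (huz : u ≠ z)
    (huw : u ≠ w) (hvw : v ≠ w) (hzw : z ≠ w) :
    (equalPairs s (v = z)).card * Fintype.card β ^ Fintype.card V ≤
      (Finset.univ.filter fun f : V → β => s (f u) (f v) = s (f w) (f z)).card *
        Fintype.card β ^ (if v = z then 3 else 4) := by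
  have hW : ({u, w, v, z} : Finset V).card = if v = z then 3 else 4 := by
    split_ifs with h
    · subst h
      rw [Finset.card_insert_of_notMem (by simp [huw, huv]), Finset.card_insert_of_notMem
        (by simp [hvw.symm])]
      simp
    · rw [Finset.card_insert_of_notMem (by simp [huw, huv, huz]), Finset.card_insert_of_notMem
        (by simp [hvw.symm, hzw.symm]), Finset.card_pair h]
  have h1 : (equalPairs s (v = z) ×ˢ (Finset.univ : Finset (V → β))).card =
      (equalPairs s (v = z)).card * Fintype.card β ^ Fintype.card V := by
    rw [Finset.card_product, Finset.card_univ, Fintype.card_fun]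
  have h2 : ((Finset.univ.filter fun f : V → β => s (f u) (f v) = s (f w) (f z)) ×ˢ
      (Finset.univ : Finset (({u, w, v, z} : Finset V) → β))).card =
      (Finset.univ.filter fun f : V → β => s (f u) (f v) = s (f w) (f z)).card *
        Fintype.card β ^ (if v = z then 3 else 4) := by
    rw [Finset.card_product, Finset.card_univ, Fintype.card_fun, Fintype.card_coe, hW]
  rw [← h1, ← h2]
  -- The map `r` is overwritten on `u, v, w, z`; recording its old values there makes the assignment
  -- injective.
  let g : (β × β) × (β × β) → (V → β) → V → β := fun a r x =>
    if x = u then a.1.1 else if x = v then a.1.2 else if x = w then a.2.1 else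
      if x = z then a.2.2 else r x
  have gu : ∀ a r, g a r u = a.1.1 := fun a r => by simp [g]
  have gv : ∀ a r, g a r v = a.1.2 := fun a r => by simp [g, huv.symm]
  have gw : ∀ a r, g a r w = a.2.1 := fun a r => by simp [g, huw.symm, hvw.symm]
  have gz : ∀ a ∈ equalPairs s (v = z), ∀ r, g a r z = a.2.2 := by
    intro a ha r
    by_cases h : v = z
    · rw [← h, gv, (Finset.mem_filter.1 ha).2.2 h]
    · simp [g, huz.symm, Ne.symm h, hzw]
  refine Finset.card_le_card_of_injOn (fun b => (g b.1 b.2, fun x => b.2 x)) ?_ ?_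
  · rintro ⟨a, r⟩ hb
    have ha : a ∈ equalPairs s (v = z) := (Finset.mem_product.1 hb).1
    simp only [Finset.coe_product, Set.mem_prod, Finset.mem_coe, Finset.mem_filter,
      Finset.mem_univ, true_and, and_true]
    rw [gu, gv, gw, gz a ha]
    exact (Finset.mem_filter.1 ha).2.1
  · rintro ⟨a, r⟩ hb ⟨a', r'⟩ hb' heq
    have ha : a ∈ equalPairs s (v = z) := (Finset.mem_product.1 hb).1
    have ha' : a' ∈ equalPairs s (v = z) := (Finset.mem_product.1 hb').1
    simp only [Prod.mk.injEq] at heq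
    obtain ⟨hg, hr⟩ := heq
    have e1 := congrFun hg u
    have e2 := congrFun hg v
    have e3 := congrFun hg w
    have e4 := congrFun hg z
    rw [gu, gu] at e1
    rw [gv, gv] at e2
    rw [gw, gw] at e3
    rw [gz a ha, gz a' ha'] at e4
    refine Prod.ext (Prod.ext (Prod.ext e1 e2) (Prod.ext e3 e4)) (funext fun x => ?_)
    by_cases hx : x ∈ ({u, w, v, z} : Finset V)
    · exact congrFun hr ⟨x, hx⟩
    · have := congrFun hg x
      simp only [Finset.mem_insert, Finset.mem_singleton, not_or] at hx
      simpa [g, hx.1, hx.2.1, hx.2.2.1, hx.2.2.2] using this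

theorem card_pow_le_card_equal_values [Nonempty β] (s : β → β → Y) {u v z w : V} (huv : u ≠ v)
    (huz : u ≠ z) (huw : u ≠ w) (hvw : v ≠ w) (hzw : z ≠ w) :
    Fintype.card β ^ Fintype.card V ≤ Fintype.card Y *
      (Finset.univ.filter fun f : V → β => s (f u) (f v) = s (f w) (f z)).card := by
  have h1 := card_pow_le_card_equalPairs s (v = z)
  have h2 := card_equalPairs_mul_le s huv huz huw hvw hzw
  have h0 : 0 < Fintype.card β ^ (if v = z then 3 else 4) := pow_pos Fintype.card_pos _
  refine Nat.le_of_mul_le_mul_left ?_ h0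
  calc _ ≤ (Fintype.card Y * (equalPairs s (v = z)).card) * Fintype.card β ^ Fintype.card V :=
        Nat.mul_le_mul_right _ h1
    _ = Fintype.card Y * ((equalPairs s (v = z)).card * Fintype.card β ^ Fintype.card V) := by
        ring
    _ ≤ _ := Nat.mul_le_mul_left _ h2
    _ = _ := by ring

theorem card_eq_at_mul_le {a b : V} (hab : a ≠ b) :
    (Finset.univ.filter fun f : V → β => f a = f b).card * Fintype.card β ≤
      Fintype.card β ^ Fintype.card V := by
  have h1 : ((Finset.univ.filter fun f : V → β => f a = f b) ×ˢ (Finset.univ : Finset β)).card =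
      (Finset.univ.filter fun f : V → β => f a = f b).card * Fintype.card β := by
    rw [Finset.card_product, Finset.card_univ]
  rw [← h1, ← Fintype.card_fun, ← Finset.card_univ]
  refine Finset.card_le_card_of_injOn (fun c => Function.update c.1 a c.2)
    (fun _ _ => Finset.mem_coe.2 (Finset.mem_univ _)) ?_
  rintro ⟨f, x⟩ hf ⟨f', x'⟩ hf' heq
  have hf1 : f a = f b := by simpa using hf
  have hf2 : f' a = f' b := by simpa using hf'
  have hx := congrFun heq a
  simp only [Function.update_self] at hx
  have hne : ∀ y, y ≠ a → f y = f' y := fun y hy => by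
    have := congrFun heq y
    simpa [hy] using this
  refine Prod.ext (funext fun y => ?_) hx
  by_cases hy : y = a
  · subst hy
    change f y = f' y
    rw [hf1, hf2, hne b hab.symm]
  · exact hne y hy

theorem card_not_injective_mul_le :
    (Finset.univ.filter fun f : V → β => ¬ Function.Injective f).card * Fintype.card β ≤
      Fintype.card V ^ 2 * Fintype.card β ^ Fintype.card V := by
  have hsub : (Finset.univ.filter fun f : V → β => ¬ Function.Injective f) ⊆
      (Finset.univ.offDiag : Finset (V × V)).biUnion
        fun c => Finset.univ.filter fun f : V → β => f c.1 = f c.2 := by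
    intro f hf
    have hf' : ¬ Function.Injective f := by simpa using hf
    unfold Function.Injective at hf'
    push Not at hf'
    obtain ⟨a, b, h, hab⟩ := hf'
    simp only [Finset.mem_biUnion, Finset.mem_offDiag, Finset.mem_filter, Finset.mem_univ,
      true_and]
    exact ⟨(a, b), hab, h⟩
  calc _ ≤ (∑ c ∈ (Finset.univ.offDiag : Finset (V × V)),
        (Finset.univ.filter fun f : V → β => f c.1 = f c.2).card) * Fintype.card β :=
        Nat.mul_le_mul_right _ ((Finset.card_le_card hsub).trans Finset.card_biUnion_le)
    _ ≤ ∑ c ∈ (Finset.univ.offDiag : Finset (V × V)), Fintype.card β ^ Fintype.card V := by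
        rw [Finset.sum_mul]
        refine Finset.sum_le_sum fun c hc => card_eq_at_mul_le ?_
        simpa using hc
    _ ≤ _ := by
        rw [Finset.sum_const, smul_eq_mul]
        refine Nat.mul_le_mul_right _ ?_
        rw [Finset.offDiag_card, Finset.card_univ, sq]
        exact Nat.sub_le _ _

end Counting

/-! ### Few permutations leave many maps uncovered -/

section Uncovered

variable {V : Type*} [Fintype V]

open Classical in
/-- The injective maps all of whose edges point to the right in none of the permutations. -/
noncomputable def uncovered (H : Digraph V) {n t : ℕ} (π : Fin t → Equiv.Perm (Fin n)) :
    Finset (V → Fin n) :=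
  Finset.univ.filter fun f => Function.Injective f ∧
    ∀ i, ¬ ∀ u v, H.Adj u v → π i (f u) < π i (f v)

/-- If `(f u, f v)` and `(f w, f z)` have equal records, a permutation increasing along `u → v` has
`f w` before `f z` and so reverses `z → w`. The second summand accounts for non-injective maps. -/
theorem pow_le_two_pow_mul_card_uncovered {H : Digraph V} (hdag : IsDag H)
    (hiso : NoIsolatedVertices H) (hedges : 2 ≤ {e : V × V | H.Adj e.1 e.2}.ncard)
    (hstar : ¬ IsRootedStar H) {n t : ℕ} (hn : 0 < n) (π : Fin t → Equiv.Perm (Fin n)) :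
    (n : ℝ) ^ Fintype.card V ≤
      2 ^ t * ((uncovered H π).card + (Fintype.card V : ℝ) ^ 2 * n ^ Fintype.card V / n) := by
  classical
  obtain ⟨u, v, z, w, h1, h2, huv, huz, huw, hvw, hzw⟩ :=
    exists_two_edges hdag hiso hedges hstar
  have : NeZero n := ⟨hn.ne'⟩
  have hcount := card_pow_le_card_equal_values
    (fun x y : Fin n => fun i : Fin t => decide (π i x < π i y)) huv huz huw hvw hzw
  have hninj := card_not_injective_mul_le (V := V) (β := Fin n)
  simp only [Fintype.card_fin, Fintype.card_fun, Fintype.card_bool] at hcount hninj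
  set F := Finset.univ.filter fun f : V → Fin n =>
    (fun i : Fin t => decide (π i (f u) < π i (f v))) = fun i => decide (π i (f w) < π i (f z))
    with hF
  set J := Finset.univ.filter fun f : V → Fin n => ¬ Function.Injective f with hJ
  have hsub : F ⊆ uncovered H π ∪ J := by
    intro f hf
    rw [Finset.mem_union]
    by_cases hinj : Function.Injective f
    · left
      unfold uncovered
      rw [Finset.mem_filter]
      refine ⟨Finset.mem_univ _, hinj, fun i hi => ?_⟩
      have h3 := congrFun (Finset.mem_filter.1 hf).2 i
      simp only [decide_eq_decide] at h3
      exact lt_asymm (h3.1 (hi u v h1)) (hi z w h2)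
    · right
      rw [hJ, Finset.mem_filter]
      exact ⟨Finset.mem_univ _, hinj⟩
  have hc : (F.card : ℝ) ≤ (uncovered H π).card + J.card := by
    exact_mod_cast (Finset.card_le_card hsub).trans (Finset.card_union_le _ _)
  have hn' : (0 : ℝ) < n := by exact_mod_cast hn
  have hJ' : (J.card : ℝ) ≤ (Fintype.card V : ℝ) ^ 2 * n ^ Fintype.card V / n := by
    rw [le_div_iff₀ hn']
    exact_mod_cast hninj
  calc (n : ℝ) ^ Fintype.card V ≤ 2 ^ t * F.card := by exact_mod_cast hcount
    _ ≤ _ := by gcongr; linarith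

end Uncovered

/-! ### Logarithmically many permutations suffice -/

section UpperBound

theorem IsDag.exists_rank {V : Type*} [Fintype V] {H : Digraph V} (hdag : IsDag H) :
    ∃ r : V → ℕ, ∀ u v, H.Adj u v → r u < r v := by
  classical
  refine ⟨fun v => (Finset.univ.filter fun x => Relation.TransGen H.Adj x v).card,
    fun u v huv => Finset.card_lt_card ⟨fun x hx => ?_, fun hsub => ?_⟩⟩
  · simp only [Finset.mem_filter, Finset.mem_univ, true_and] at hx ⊢
    exact hx.tail huv
  · have h := hsub (x := u) (by
      simp only [Finset.mem_filter, Finset.mem_univ, true_and]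
      exact .single huv)
    simp only [Finset.mem_filter, Finset.mem_univ, true_and] at h
    exact hdag u h

/-- An injective labelling of a directed acyclic graph becomes increasing along all edges after a
permutation of the labels. -/
theorem IsDag.exists_perm_increasing {V α : Type*} [Fintype V] [LinearOrder α] {H : Digraph V}
    (hdag : IsDag H) {k : V → α} (hk : Function.Injective k) :
    ∃ σ : Equiv.Perm V, ∀ u v, H.Adj u v → k (σ u) < k (σ v) := by
  obtain ⟨r, hr⟩ := hdag.exists_rank
  let e := Fintype.equivFin V
  let ρ₁ := Tuple.sort (r ∘ e.symm)
  let ρ₂ := Tuple.sort (k ∘ e.symm)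
  have h1 : Monotone ((r ∘ e.symm) ∘ ρ₁) := Tuple.monotone_sort _
  have h2 : StrictMono ((k ∘ e.symm) ∘ ρ₂) := (Tuple.monotone_sort _).strictMono_of_injective
    ((hk.comp e.symm.injective).comp ρ₂.injective)
  refine ⟨((e.trans ρ₁.symm).trans ρ₂).trans e.symm, fun u v huv => ?_⟩
  refine h2 (a := ρ₁.symm (e u)) (b := ρ₁.symm (e v)) ?_
  by_contra hle
  have h3 := h1 (not_lt.1 hle)
  simp only [Function.comp_apply, Equiv.apply_symm_apply, Equiv.symm_apply_apply] at h3
  exact absurd (hr u v huv) (not_lt.2 h3)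

variable {V : Type*} [Fintype V]

-- Every permutation covers `f` after some rearrangement of the image of `f`; it is recovered from
-- the result and the rearrangement, one of `h!`.
open Classical in
theorem factorial_le_mul_card_covering {H : Digraph V} (hdag : IsDag H) {n : ℕ} {f : V → Fin n}
    (hf : Function.Injective f) :
    n.factorial ≤ (Fintype.card V).factorial * (Finset.univ.filter fun π : Equiv.Perm (Fin n) =>
      ∀ u v, H.Adj u v → π (f u) < π (f v)).card := by
  choose σ hσ using fun π : Equiv.Perm (Fin n) =>
    hdag.exists_perm_increasing (k := fun v => π (f v)) (π.injective.comp hf)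
  let ext : Equiv.Perm V → Equiv.Perm (Fin n) := fun τ => τ.viaFintypeEmbedding ⟨f, hf⟩
  have hext : ∀ τ v, ext τ (f v) = f (τ v) := fun τ v =>
    Equiv.Perm.viaFintypeEmbedding_apply_image τ ⟨f, hf⟩ v
  have hcard : n.factorial = (Finset.univ : Finset (Equiv.Perm (Fin n))).card := by
    rw [Finset.card_univ, Fintype.card_perm, Fintype.card_fin]
  rw [hcard, ← Fintype.card_perm, ← Finset.card_univ, ← Finset.card_product]
  refine Finset.card_le_card_of_injOn (fun π => (σ π, π * ext (σ π))) ?_ ?_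
  · intro π _
    simp only [Finset.coe_product, Set.mem_prod, Finset.mem_coe, Finset.mem_filter,
      Finset.mem_univ, true_and, Equiv.Perm.mul_apply, hext]
    exact hσ π
  · intro π _ π' _ h
    simp only [Prod.mk.injEq] at h
    obtain ⟨h1, h2⟩ := h
    rw [h1] at h2
    exact mul_right_cancel h2

open Classical in
theorem exists_perm_covering_fraction {H : Digraph V} (hdag : IsDag H) {n : ℕ}
    (R : Finset (V → Fin n)) (hR : ∀ f ∈ R, Function.Injective f) :
    ∃ π : Equiv.Perm (Fin n), R.card ≤ (Fintype.card V).factorial *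
      (R.filter fun f => ∀ u v, H.Adj u v → π (f u) < π (f v)).card := by
  by_contra! h
  have h1 : ∑ π : Equiv.Perm (Fin n), (Fintype.card V).factorial *
      (R.filter fun f => ∀ u v, H.Adj u v → π (f u) < π (f v)).card <
      ∑ π : Equiv.Perm (Fin n), R.card :=
    Finset.sum_lt_sum_of_nonempty Finset.univ_nonempty fun π _ => h π
  rw [Finset.sum_const, Finset.card_univ, Fintype.card_perm, Fintype.card_fin, smul_eq_mul,
    ← Finset.mul_sum] at h1
  have h2 : ∑ π : Equiv.Perm (Fin n),
      (R.filter fun f => ∀ u v, H.Adj u v → π (f u) < π (f v)).card =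
      ∑ f ∈ R, (Finset.univ.filter fun π : Equiv.Perm (Fin n) =>
        ∀ u v, H.Adj u v → π (f u) < π (f v)).card := by
    simp only [Finset.card_filter]
    exact Finset.sum_comm
  rw [h2, Finset.mul_sum] at h1
  have h3 : ∑ f ∈ R, n.factorial ≤ _ :=
    Finset.sum_le_sum fun f hf => factorial_le_mul_card_covering hdag (hR f hf)
  rw [Finset.sum_const, smul_eq_mul, mul_comm] at h3
  exact absurd h1 (not_lt.2 h3)

/-- Greedy choice: each new permutation covers at least the average fraction `1/h!` of what is left.
-/
theorem exists_card_uncovered_le {H : Digraph V} (hdag : IsDag H) (n t : ℕ) :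
    ∃ π : Fin t → Equiv.Perm (Fin n), ((uncovered H π).card : ℝ) ≤
      (1 - 1 / (Fintype.card V).factorial : ℝ) ^ t * (n : ℝ) ^ Fintype.card V := by
  classical
  have hpos : (0 : ℝ) < (Fintype.card V).factorial := by exact_mod_cast Nat.factorial_pos _
  have hone : (1 : ℝ) ≤ (Fintype.card V).factorial := by
    exact_mod_cast Nat.factorial_pos _
  induction t with
  | zero =>
    refine ⟨Fin.elim0, ?_⟩
    rw [pow_zero, one_mul]
    have := Finset.card_le_univ (uncovered H (Fin.elim0 : Fin 0 → Equiv.Perm (Fin n)))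
    rw [Fintype.card_fun, Fintype.card_fin] at this
    exact_mod_cast this
  | succ t ih =>
    obtain ⟨π, hπ⟩ := ih
    obtain ⟨ρ, hρ⟩ := exists_perm_covering_fraction hdag (uncovered H π)
      fun f hf => (Finset.mem_filter.1 hf).2.1
    refine ⟨Fin.cons ρ π, ?_⟩
    have hsub : uncovered H (Fin.cons ρ π : Fin (t + 1) → Equiv.Perm (Fin n)) ⊆
        (uncovered H π).filter fun f => ¬ ∀ u v, H.Adj u v → ρ (f u) < ρ (f v) := by
      intro f hf
      obtain ⟨hinj, hall⟩ := (Finset.mem_filter.1 hf).2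
      rw [Finset.mem_filter]
      refine ⟨Finset.mem_filter.2 ⟨Finset.mem_univ _, hinj, fun i => ?_⟩, ?_⟩
      · have := hall i.succ
        simpa only [Fin.cons_succ] using this
      · have := hall 0
        simpa only [Fin.cons_zero] using this
    have h1 := Finset.card_le_card hsub
    have h2 := Finset.card_filter_add_card_filter_not (s := uncovered H π)
      (fun f => ∀ u v, H.Adj u v → ρ (f u) < ρ (f v))
    set x := ((uncovered H π).filter fun f => ∀ u v, H.Adj u v → ρ (f u) < ρ (f v)).card
    have h3 : ((uncovered H π).card : ℝ) / (Fintype.card V).factorial ≤ x := by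
      rw [div_le_iff₀' hpos]
      exact_mod_cast hρ
    have h4 : ((uncovered H (Fin.cons ρ π : Fin (t + 1) → Equiv.Perm (Fin n))).card : ℝ) + x ≤
        (uncovered H π).card := by
      rw [← h2]
      push_cast
      have : ((uncovered H (Fin.cons ρ π : Fin (t + 1) → Equiv.Perm (Fin n))).card : ℝ) ≤ _ :=
        Nat.cast_le.2 h1
      linarith
    have h5 : (0 : ℝ) ≤ 1 - 1 / (Fintype.card V).factorial := by
      rw [sub_nonneg, div_le_one hpos]
      exact hone
    calc _ ≤ (1 - 1 / (Fintype.card V).factorial : ℝ) * (uncovered H π).card := by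
          rw [sub_mul, one_mul, one_div_mul_eq_div]
          linarith
      _ ≤ _ := by
          rw [pow_succ', mul_assoc]
          exact mul_le_mul_of_nonneg_left hπ h5

theorem coversAllCopies_of_uncovered_eq_empty {H : Digraph V} {n t : ℕ}
    {π : Fin t → Equiv.Perm (Fin n)} (h : uncovered H π = ∅) (G : Digraph (Fin n)) :
    CoversAllCopies H G π := by
  classical
  intro f hf
  by_contra! hc
  have : f ∈ uncovered H π := by
    refine Finset.mem_filter.2 ⟨Finset.mem_univ _, hf.1, fun i hi => ?_⟩
    obtain ⟨u, v, huv, hn⟩ := hc i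
    exact hn ⟨hf.2 u v huv, hi u v huv⟩
  simp [h] at this

/-- The covering number of every directed graph is at most logarithmic. -/
theorem exists_coversAllCopies {H : Digraph V} (hdag : IsDag H) {n : ℕ} (hn : 2 ≤ n) :
    ∃ t : ℕ, (t : ℝ) ≤
        ((Fintype.card V).factorial * Fintype.card V + 1 : ℝ) * Real.logb 2 n ∧
      ∃ π : Fin t → Equiv.Perm (Fin n), ∀ G : Digraph (Fin n), CoversAllCopies H G π := by
  have hn0 : (0 : ℝ) < n := by positivity
  have hn2 : (2 : ℝ) ≤ n := by exact_mod_cast hn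
  have hpos : (0 : ℝ) < (Fintype.card V).factorial := by exact_mod_cast Nat.factorial_pos _
  -- For `t > x` one has `(1 - 1/h!)^t * n^h ≤ exp(-t/h! + h log n) < 1`, so no map is left.
  set x : ℝ := (Fintype.card V).factorial * Fintype.card V * Real.log n with hx
  have hlog : 0 ≤ Real.log n := Real.log_nonneg (by linarith)
  refine ⟨⌊x⌋₊ + 1, ?_, ?_⟩
  · have h1 : Real.log n ≤ Real.logb 2 n := by
      rw [Real.logb, le_div_iff₀ (Real.log_pos (by norm_num))]
      have : Real.log 2 ≤ 1 := by
        have := Real.log_two_lt_d9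
        linarith
      exact mul_le_of_le_one_right hlog this
    have h2 : 1 ≤ Real.logb 2 n := by
      rw [Real.le_logb_iff_rpow_le (by norm_num) hn0, Real.rpow_one]
      exact hn2
    have h3 : (⌊x⌋₊ : ℝ) ≤ x := Nat.floor_le (by positivity)
    have h4 : x ≤ (Fintype.card V).factorial * Fintype.card V * Real.logb 2 n :=
      mul_le_mul_of_nonneg_left h1 (by positivity)
    push_cast
    linarith
  · obtain ⟨π, hπ⟩ := exists_card_uncovered_le hdag n (⌊x⌋₊ + 1)
    refine ⟨π, fun G => coversAllCopies_of_uncovered_eq_empty ?_ G⟩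
    rw [← Finset.card_eq_zero]
    have hlt : ((uncovered H π).card : ℝ) < 1 := by
      refine hπ.trans_lt ?_
      have h1 : (1 - 1 / (Fintype.card V).factorial : ℝ) ≤
          Real.exp (-(1 / (Fintype.card V).factorial)) := by
        have := Real.add_one_le_exp (-(1 / (Fintype.card V).factorial : ℝ))
        linarith
      have h0 : (0 : ℝ) ≤ 1 - 1 / (Fintype.card V).factorial := by
        rw [sub_nonneg, div_le_one hpos]
        exact_mod_cast Nat.factorial_pos _
      have h2 : (n : ℝ) ^ Fintype.card V = Real.exp (Fintype.card V * Real.log n) := by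
        rw [mul_comm, Real.exp_mul, Real.exp_log hn0, Real.rpow_natCast]
      calc _ ≤ Real.exp (-(1 / (Fintype.card V).factorial)) ^ (⌊x⌋₊ + 1) *
            (n : ℝ) ^ Fintype.card V := by gcongr
        _ < 1 := by
          rw [h2, ← Real.exp_nat_mul, ← Real.exp_add, Real.exp_lt_one_iff]
          have h3 : x < ((⌊x⌋₊ + 1 : ℕ) : ℝ) := by
            push_cast
            exact Nat.lt_floor_add_one x
          have h4 : Fintype.card V * Real.log n = x * (1 / (Fintype.card V).factorial) := by
            rw [hx]
            field_simp
          rw [h4]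
          have := mul_lt_mul_of_pos_right h3 (one_div_pos.2 hpos)
          linarith
    exact_mod_cast Nat.lt_one_iff.1 (by exact_mod_cast hlt)

end UpperBound

/-! ### Edge density of subgraphs -/

section Arboricity

set_option linter.unusedSectionVars false

variable {V : Type*} [Fintype V]

theorem card_le_fractionalArboricity_mul (H : Digraph V) {S : Finset V} {E : Finset (V × V)}
    (hS : 2 ≤ S.card) (hE : IsSubgraphPair H S E) :
    (E.card : ℝ) ≤ fractionalArboricity H * (S.card - 1) := by
  have hfin : {x : ℝ | ∃ (S : Finset V) (E : Finset (V × V)),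
      2 ≤ S.card ∧ IsSubgraphPair H S E ∧ x = (E.card : ℝ) / ((S.card : ℝ) - 1)}.Finite := by
    refine (Set.finite_range fun c : Finset V × Finset (V × V) =>
      (c.2.card : ℝ) / ((c.1.card : ℝ) - 1)).subset ?_
    rintro x ⟨S, E, _, _, rfl⟩
    exact ⟨(S, E), rfl⟩
  have hS' : (2 : ℝ) ≤ S.card := by exact_mod_cast hS
  rw [← div_le_iff₀ (by linarith)]
  exact le_csSup hfin.bddAbove ⟨S, E, hS, hE, rfl⟩

open Classical in
/-- The edges of a digraph as a finite set. -/
noncomputable def edges (H : Digraph V) : Finset (V × V) :=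
  Finset.univ.filter fun e => H.Adj e.1 e.2

theorem mem_edges {H : Digraph V} {e : V × V} : e ∈ edges H ↔ H.Adj e.1 e.2 := by
  simp [edges]

theorem card_edges (H : Digraph V) : (edges H).card = {e : V × V | H.Adj e.1 e.2}.ncard := by
  rw [← Set.ncard_coe_finset]
  congr 1
  ext e
  simp [mem_edges]

theorem two_le_card_of_adj {H : Digraph V} (hloop : ∀ a b, H.Adj a b → a ≠ b) {S : Finset V}
    {E : Finset (V × V)} (hE : IsSubgraphPair H S E) (hne : E.Nonempty) : 2 ≤ S.card := by
  obtain ⟨e, he⟩ := hne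
  obtain ⟨h1, h2, h3⟩ := hE e he
  exact Finset.one_lt_card.2 ⟨e.1, h1, e.2, h2, hloop _ _ h3⟩

theorem fractionalArboricity_pos {H : Digraph V} (hloop : ∀ a b, H.Adj a b → a ≠ b)
    (hne : (edges H).Nonempty) : 0 < fractionalArboricity H := by
  have hp : IsSubgraphPair H Finset.univ (edges H) := fun e he =>
    ⟨Finset.mem_univ _, Finset.mem_univ _, mem_edges.1 he⟩
  have h2 := two_le_card_of_adj hloop hp hne
  have h := card_le_fractionalArboricity_mul H h2 hp
  have h2' : (2 : ℝ) ≤ (Finset.univ : Finset V).card := by exact_mod_cast h2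
  have h3 : (0 : ℝ) < (edges H).card := by exact_mod_cast hne.card_pos
  by_contra hc
  have := mul_nonpos_of_nonpos_of_nonneg (not_lt.1 hc)
    (by linarith : (0 : ℝ) ≤ (Finset.univ : Finset V).card - 1)
  linarith

/-- The form in which the arboricity is used: with `p = n^(-1/a)` it says `n^s p^e ≥ n^(1+δ)`. The
gain `δ (s - 1)` is at least `δ` because `s ≥ 2`. -/
theorem card_div_le {H : Digraph V} {a : ℝ} (ha0 : 0 < a) (ha : fractionalArboricity H < a)
    {S : Finset V} {E : Finset (V × V)} (hS : 2 ≤ S.card) (hE : IsSubgraphPair H S E) :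
    (E.card : ℝ) / a ≤ S.card - 1 - (1 - fractionalArboricity H / a) := by
  have h := card_le_fractionalArboricity_mul H hS hE
  have hS' : (2 : ℝ) ≤ S.card := by exact_mod_cast hS
  have h1 : (E.card : ℝ) / a ≤ fractionalArboricity H / a * (S.card - 1) := by
    rw [div_mul_eq_mul_div]
    gcongr
  have h2 : fractionalArboricity H / a < 1 := (div_lt_one ha0).2 ha
  nlinarith

end Arboricity

/-! ### Correlations of copies and the failure probability of one family -/

section Overlaps

variable {V : Type*} [Fintype V]

/-- The image of the edge set under a map of the vertices. -/
noncomputable def edgeImage (H : Digraph V) {n : ℕ} (f : V → Fin n) :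
    Finset (Fin n × Fin n) :=
  (edges H).image (Prod.map f f)

theorem card_edgeImage (H : Digraph V) {n : ℕ} {f : V → Fin n} (hf : Function.Injective f) :
    (edgeImage H f).card = (edges H).card :=
  Finset.card_image_of_injective _ (hf.prodMap hf)

open Classical in
/-- The number of vertices mapped to the range of another map. -/
noncomputable def overlap {n : ℕ} (f g : V → Fin n) : ℕ :=
  (Finset.univ.filter fun v => f v ∈ Set.range g).card

/-- For fixed `g` the sum over `f` is a product over the vertices, each factor being at most `h * n
+ n`. Thus the weight `n^s` of an overlap in `s` vertices is paid for by its rarity. -/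
theorem sum_pow_overlap_le [DecidableEq V] (n : ℕ) :
    ∑ f : V → Fin n, ∑ g : V → Fin n, (n : ℝ) ^ overlap f g ≤
      ((Fintype.card V : ℝ) + 1) ^ Fintype.card V * n ^ (2 * Fintype.card V) := by
  rw [Finset.sum_comm]
  have hg : ∀ g : V → Fin n, ∑ f : V → Fin n, (n : ℝ) ^ overlap f g ≤
      (((Fintype.card V : ℝ) + 1) * n) ^ Fintype.card V := by
    intro g
    have h1 : ∀ f : V → Fin n, (n : ℝ) ^ overlap f g =
        ∏ v, if f v ∈ Set.range g then (n : ℝ) else 1 := by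
      intro f
      rw [Finset.prod_ite, Finset.prod_const, Finset.prod_const_one, mul_one, overlap]
    simp only [h1]
    have h2 := Finset.prod_univ_sum (fun _ : V => (Finset.univ : Finset (Fin n)))
      fun _ x => if x ∈ Set.range g then (n : ℝ) else 1
    rw [Fintype.piFinset_univ] at h2
    rw [← h2, Finset.prod_const, Finset.card_univ]
    refine pow_le_pow_left₀ (Finset.sum_nonneg fun x _ => by split_ifs <;> positivity) ?_ _
    have h3 : ∀ x, (if x ∈ Set.range g then (n : ℝ) else 1) ≤
        (if x ∈ Finset.univ.image g then (n : ℝ) else 0) + 1 := by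
      intro x
      by_cases hx : x ∈ Set.range g
      · have hx' : x ∈ Finset.univ.image g := by simpa using hx
        rw [if_pos hx, if_pos hx']
        linarith
      · have hx' : x ∉ Finset.univ.image g := by simpa using hx
        rw [if_neg hx, if_neg hx']
        linarith
    refine (Finset.sum_le_sum fun x _ => h3 x).trans ?_
    rw [Finset.sum_add_distrib, ← Finset.sum_filter, Finset.sum_const, Finset.sum_const,
      Finset.card_univ, Fintype.card_fin, nsmul_eq_mul, nsmul_eq_mul, mul_one, add_mul, one_mul,
      Finset.filter_mem_eq_inter, Finset.univ_inter]
    gcongr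
    exact Finset.card_image_le
  calc _ ≤ ∑ g : V → Fin n, (((Fintype.card V : ℝ) + 1) * n) ^ Fintype.card V :=
        Finset.sum_le_sum fun g _ => hg g
    _ = _ := by
        rw [Finset.sum_const, Finset.card_univ, Fintype.card_fun, Fintype.card_fin, nsmul_eq_mul,
          mul_pow]
        push_cast
        ring

/-- The common edges form a subgraph of `H` on the overlapping vertices. Sharing `e` edges gains a
factor `p^(-e) = n^(e/a)`, which `card_div_le` bounds by `n^(s-1-δ)`. -/
theorem jointProb_edgeImage_le {H : Digraph V} (hloop : ∀ a b, H.Adj a b → a ≠ b) {a : ℝ}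
    (ha0 : 0 < a) (ha : fractionalArboricity H < a) {n : ℕ} (hn : 0 < n) {f g : V → Fin n}
    (hf : Function.Injective f) (hg : Function.Injective g) :
    jointProb (edgeImage H) ((n : ℝ) ^ (-1 / a)) f g ≤
      ((n : ℝ) ^ (-1 / a)) ^ (2 * (edges H).card) *
        (n : ℝ) ^ (-1 - (1 - fractionalArboricity H / a)) * (n : ℝ) ^ overlap f g := by
  classical
  have hn0 : (0 : ℝ) < n := by exact_mod_cast hn
  have hn1 : (1 : ℝ) ≤ n := by exact_mod_cast hn
  unfold jointProb
  split_ifs with h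
  swap
  · positivity
  obtain ⟨_, hd⟩ := h
  set S : Finset V := Finset.univ.filter fun v => f v ∈ Set.range g with hS
  set E := (edges H).filter fun e => Prod.map f f e ∈ edgeImage H g with hE
  have hES : IsSubgraphPair H S E := by
    intro e he
    obtain ⟨he1, he2⟩ := Finset.mem_filter.1 he
    obtain ⟨e', _, he'⟩ := Finset.mem_image.1 he2
    have h1 := congrArg Prod.fst he'
    have h2 := congrArg Prod.snd he'
    simp only [Prod.map_fst, Prod.map_snd] at h1 h2
    exact ⟨Finset.mem_filter.2 ⟨Finset.mem_univ _, _, h1⟩,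
      Finset.mem_filter.2 ⟨Finset.mem_univ _, _, h2⟩, mem_edges.1 he1⟩
  have hEimg : E.image (Prod.map f f) = edgeImage H f ∩ edgeImage H g := by
    ext x
    simp only [hE, edgeImage, Finset.mem_image, Finset.mem_filter, Finset.mem_inter]
    constructor
    · rintro ⟨e, ⟨h1, h2⟩, rfl⟩
      exact ⟨⟨e, h1, rfl⟩, h2⟩
    · rintro ⟨⟨e, h1, rfl⟩, h2⟩
      exact ⟨e, ⟨h1, h2⟩, rfl⟩
  have hEcard : E.card = (edgeImage H f ∩ edgeImage H g).card := by
    rw [← hEimg, Finset.card_image_of_injective _ (hf.prodMap hf)]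
  have hne : E.Nonempty := by
    rw [← Finset.card_pos, hEcard, Finset.card_pos]
    exact Finset.not_disjoint_iff_nonempty_inter.1 hd
  have hbound := card_div_le ha0 ha (two_le_card_of_adj hloop hES hne) hES
  have hcard : (edgeImage H f ∪ edgeImage H g).card + E.card = 2 * (edges H).card := by
    rw [hEcard, Finset.card_union_add_card_inter, card_edgeImage H hf, card_edgeImage H hg, two_mul]
  have hcard' : ((edgeImage H f ∪ edgeImage H g).card : ℝ) + E.card =
      ((2 * (edges H).card : ℕ) : ℝ) := by exact_mod_cast hcard
  rw [← Real.rpow_natCast, ← Real.rpow_natCast, ← Real.rpow_natCast, ← Real.rpow_mul hn0.le,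
    ← Real.rpow_mul hn0.le, ← Real.rpow_add hn0, ← Real.rpow_add hn0]
  refine Real.rpow_le_rpow_of_exponent_le hn1 ?_
  rw [← hcard']
  change _ ≤ _ + _ + (S.card : ℝ)
  have e1 : -1 / a * (((edgeImage H f ∪ edgeImage H g).card : ℝ) + E.card) =
    -1 / a * ((edgeImage H f ∪ edgeImage H g).card : ℝ) - E.card / a := by ring
  rw [e1]
  linarith

theorem sum_jointProb_le {H : Digraph V} (hloop : ∀ a b, H.Adj a b → a ≠ b) {a : ℝ}
    (ha0 : 0 < a) (ha : fractionalArboricity H < a) {n : ℕ} (hn : 0 < n)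
    (B : Finset (V → Fin n)) (hB : ∀ f ∈ B, Function.Injective f) :
    ∑ f ∈ B, ∑ g ∈ B, jointProb (edgeImage H) ((n : ℝ) ^ (-1 / a)) f g ≤
      ((n : ℝ) ^ (-1 / a)) ^ (2 * (edges H).card) *
        (n : ℝ) ^ (-1 - (1 - fractionalArboricity H / a)) *
        (((Fintype.card V : ℝ) + 1) ^ Fintype.card V * n ^ (2 * Fintype.card V)) := by
  classical
  refine le_trans ?_ (mul_le_mul_of_nonneg_left (sum_pow_overlap_le (V := V) n) (by positivity))
  rw [Finset.mul_sum]
  simp only [Finset.mul_sum]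
  calc _ ≤ ∑ f ∈ B, ∑ g ∈ B, ((n : ℝ) ^ (-1 / a)) ^ (2 * (edges H).card) *
        (n : ℝ) ^ (-1 - (1 - fractionalArboricity H / a)) * (n : ℝ) ^ overlap f g :=
        Finset.sum_le_sum fun f hf => Finset.sum_le_sum fun g hg =>
          jointProb_edgeImage_le hloop ha0 ha hn (hB f hf) (hB g hg)
    _ ≤ ∑ f ∈ B, ∑ g, ((n : ℝ) ^ (-1 / a)) ^ (2 * (edges H).card) *
        (n : ℝ) ^ (-1 - (1 - fractionalArboricity H / a)) * (n : ℝ) ^ overlap f g :=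
        Finset.sum_le_sum fun f _ => Finset.sum_le_sum_of_subset_of_nonneg
          (Finset.subset_univ _) fun _ _ _ => by positivity
    _ ≤ _ := Finset.sum_le_sum_of_subset_of_nonneg (Finset.subset_univ _)
          fun _ _ _ => Finset.sum_nonneg fun _ _ => by positivity

theorem randomDigraphProb_covers_le_bernExp {H : Digraph V} {n t : ℕ} (p : unitInterval) (π : Fin t → Equiv.Perm (Fin n)) :
    randomDigraphProb n p (fun G => CoversAllCopies H G π) ≤
      ENNReal.ofReal (bernExp (Finset.univ.filter fun e : Fin n × Fin n => e.1 ≠ e.2) p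
        (noneInd (edgeImage H) (uncovered H π))) := by
  classical
  unfold randomDigraphProb
  have hu : {e : Fin n × Fin n | e.1 ≠ e.2} =
      ((Finset.univ.filter fun e : Fin n × Fin n => e.1 ≠ e.2 : Finset _) : Set _) := by
    ext; simp
  rw [hu, setBernoulli_eq_bernExp _ p fun E => CoversAllCopies H (ofEdgeSet E) π]
  refine ENNReal.ofReal_le_ofReal (bernExp_mono p.2.1 p.2.2 fun S => ?_)
  split_ifs with hcov
  · unfold noneInd
    rw [if_pos]
    intro f hf hfS
    obtain ⟨hinj, hunc⟩ := (Finset.mem_filter.1 hf).2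
    obtain ⟨i, hi⟩ := hcov f ⟨hinj, fun u v huv =>
      hfS (Finset.mem_image.2 ⟨(u, v), mem_edges.2 huv, rfl⟩)⟩
    exact hunc i fun u v huv => (hi u v huv).2
  · exact noneInd_nonneg _ _ _

/-- A short family of permutations is very unlikely to cover all copies. -/
theorem randomDigraphProb_covers_le {H : Digraph V} (hdag : IsDag H)
    (hiso : NoIsolatedVertices H) (hedges : 2 ≤ {e : V × V | H.Adj e.1 e.2}.ncard)
    (hstar : ¬ IsRootedStar H) {a δ : ℝ} (ha : fractionalArboricity H < a)
    (hδ : δ = 1 - fractionalArboricity H / a) {n t : ℕ} (hn : 0 < n)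
    (ht : (2 : ℝ) ^ t ≤ (n : ℝ) ^ (δ / 4))
    (ht' : 2 * (Fintype.card V : ℝ) ^ 2 * (n : ℝ) ^ (δ / 4) ≤ n)
    (π : Fin t → Equiv.Perm (Fin n)) :
    randomDigraphProb n (edgeProb a n) (fun G => CoversAllCopies H G π) ≤
      ENNReal.ofReal (Real.exp (-((n : ℝ) ^ (1 + δ / 2) /
        (16 * ((Fintype.card V : ℝ) + 1) ^ Fintype.card V)))) := by
  classical
  have hloop : ∀ a b, H.Adj a b → a ≠ b := by
    rintro a b h rfl
    exact hdag a (.single h)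
  have hn0 : (0 : ℝ) < n := by exact_mod_cast hn
  have hn1 : (1 : ℝ) ≤ n := by exact_mod_cast hn
  have hne : (edges H).Nonempty := by
    rw [← Finset.card_pos, card_edges]
    omega
  have hb0 := fractionalArboricity_pos hloop hne
  have ha0 : 0 < a := hb0.trans ha
  have hδ0 : 0 < δ := by
    rw [hδ, sub_pos]
    exact (div_lt_one ha0).2 ha
  have hpair : IsSubgraphPair H Finset.univ (edges H) := fun e he =>
    ⟨Finset.mem_univ _, Finset.mem_univ _, mem_edges.1 he⟩
  have he := card_div_le ha0 ha (two_le_card_of_adj hloop hpair hne) hpair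
  rw [← hδ, Finset.card_univ] at he
  refine (randomDigraphProb_covers_le_bernExp _ π).trans (ENNReal.ofReal_le_ofReal ?_)
  set B := uncovered H π with hB
  have hBinj : ∀ f ∈ B, Function.Injective f := fun f hf => (Finset.mem_filter.1 hf).2.1
  set h := Fintype.card V with hh
  set K : ℝ := ((h : ℝ) + 1) ^ h with hK
  have hK1 : 1 ≤ K := one_le_pow₀ (by have : (0 : ℝ) ≤ h := by positivity
                                      linarith)
  have hsum := sum_jointProb_le hloop ha0 ha hn B hBinj
  rw [← hδ] at hsum
  have hbad := pow_le_two_pow_mul_card_uncovered hdag hiso hedges hstar hn π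
  rw [coe_edgeProb ha0]
  set p : ℝ := (n : ℝ) ^ (-1 / a) with hp
  have hp0 : 0 < p := by positivity
  have hp1 : p ≤ 1 := by
    refine Real.rpow_le_one_of_one_le_of_nonpos hn1 ?_
    rw [neg_div]
    have : 0 < 1 / a := by positivity
    linarith
  have hμ : (n : ℝ) ^ (1 + δ) ≤ p ^ (edges H).card * (n : ℝ) ^ h := by
    rw [hp, ← Real.rpow_natCast, ← Real.rpow_natCast, ← Real.rpow_mul hn0.le, ← Real.rpow_add hn0]
    refine Real.rpow_le_rpow_of_exponent_le hn1 ?_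
    have : -1 / a * ((edges H).card : ℝ) = -((edges H).card / a) := by ring
    rw [this]
    linarith
  set μ : ℝ := p ^ (edges H).card * (n : ℝ) ^ h with hμdef
  have hμ0 : 0 < μ := by positivity
  -- The thinning parameter is `q = y / μ`, where `μ` is the expected count over all maps. The
  -- choice of `y` makes the first-order term at least `n^(1+δ/2)/(8K)` and the correlation term at
  -- most half of this.
  set y : ℝ := (n : ℝ) ^ (1 + δ - δ / 4) / (4 * K) with hy
  have hy0 : 0 < y := by positivity
  have hyμ : y ≤ μ := by
    refine le_trans ?_ hμ
    refine (div_le_self (by positivity) (by linarith)).trans ?_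
    exact Real.rpow_le_rpow_of_exponent_le hn1 (by linarith)
  have hA : ∀ f ∈ B, edgeImage H f ⊆ Finset.univ.filter fun e : Fin n × Fin n => e.1 ≠ e.2 := by
    intro f hf x hx
    obtain ⟨e, he, rfl⟩ := Finset.mem_image.1 hx
    rw [Finset.mem_filter]
    exact ⟨Finset.mem_univ _, (hBinj f hf).ne (hloop _ _ (mem_edges.1 he))⟩
  have hjan := bernExp_noneInd_le_of_thinning hp0.le hp1 (q := y / μ) (by positivity)
    ((div_le_one hμ0).2 hyμ) B hA
  refine hjan.trans (Real.exp_le_exp.2 (neg_le_neg ?_))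
  rw [Finset.sum_congr rfl fun f hf => by rw [card_edgeImage H (hBinj f hf)], Finset.sum_const,
    nsmul_eq_mul]
  -- By `ht'`, non-injective maps account for at most half of the coincidences guaranteed by
  -- counting.
  have hBlow : (n : ℝ) ^ h * (n : ℝ) ^ (-(δ / 4)) / 2 ≤ B.card := by
    set Q : ℝ := (n : ℝ) ^ (δ / 4) with hQ
    have hQ0 : 0 < Q := by positivity
    rw [Real.rpow_neg hn0.le, ← hQ]
    have h1 : (n : ℝ) ^ h ≤ Q * (B.card + (h : ℝ) ^ 2 * n ^ h / n) :=
      hbad.trans (mul_le_mul_of_nonneg_right ht (by positivity))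
    have h2 : Q * ((h : ℝ) ^ 2 * n ^ h / n) ≤ (n : ℝ) ^ h / 2 := by
      have : Q * ((h : ℝ) ^ 2 * n ^ h / n) = (2 * (h : ℝ) ^ 2 * Q) * (n ^ h / n / 2) := by ring
      rw [this]
      calc _ ≤ (n : ℝ) * (n ^ h / n / 2) := mul_le_mul_of_nonneg_right ht' (by positivity)
        _ = _ := by field_simp
    rw [← div_eq_mul_inv, div_div, div_le_iff₀ (by positivity)]
    linarith
  have hM : y * (n : ℝ) ^ (-(δ / 4)) / 2 ≤ y / μ * (B.card * p ^ (edges H).card) := by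
    calc _ = y / μ * ((n : ℝ) ^ h * (n : ℝ) ^ (-(δ / 4)) / 2 * p ^ (edges H).card) := by
          rw [hμdef]
          field_simp
      _ ≤ _ := by gcongr
  have hD : (y / μ) ^ 2 * ∑ f ∈ B, ∑ g ∈ B, jointProb (edgeImage H) p f g ≤
      y ^ 2 * (n : ℝ) ^ (-1 - δ) * K := by
    calc _ ≤ (y / μ) ^ 2 * (p ^ (2 * (edges H).card) * (n : ℝ) ^ (-1 - δ) * (K * n ^ (2 * h))) := by
          gcongr
      _ = _ := by
          rw [hμdef]
          field_simp
          ring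
  refine le_trans ?_ (sub_le_sub hM hD)
  apply le_of_eq
  have e1 : y * (n : ℝ) ^ (-(δ / 4)) = (n : ℝ) ^ (1 + δ / 2) / (4 * K) := by
    rw [hy, div_mul_eq_mul_div, ← Real.rpow_add hn0]
    congr 2
    ring
  have e2 : y ^ 2 * (n : ℝ) ^ (-1 - δ) * K = (n : ℝ) ^ (1 + δ / 2) / (16 * K) := by
    have : ((n : ℝ) ^ (1 + δ - δ / 4)) ^ 2 * (n : ℝ) ^ (-1 - δ) = (n : ℝ) ^ (1 + δ / 2) := by
      rw [sq, ← Real.rpow_add hn0, ← Real.rpow_add hn0]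
      congr 1
      ring
    rw [← this, hy]
    field_simp
    norm_num
  rw [e1, e2]
  field_simp
  norm_num

end Overlaps

/-! ### The union bound and passage to the limit -/

section Asymptotics

theorem tau_spec {V : Type*} {n : ℕ} {H : Digraph V} {G : Digraph (Fin n)}
    (h : ∃ t : ℕ, ∃ π : Fin t → Equiv.Perm (Fin n), CoversAllCopies H G π) {t : ℕ}
    (ht : tau H G ≤ t) : ∃ π : Fin t → Equiv.Perm (Fin n), CoversAllCopies H G π := by
  obtain ⟨π, hπ⟩ : ∃ π : Fin (tau H G) → Equiv.Perm (Fin n), CoversAllCopies H G π :=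
    Nat.sInf_mem h
  -- Padding with identity permutations cannot uncover a copy.
  refine ⟨fun i => if hi : (i : ℕ) < tau H G then π ⟨i, hi⟩ else 1, fun f hf => ?_⟩
  obtain ⟨i, hi⟩ := hπ f hf
  refine ⟨Fin.castLE ht i, ?_⟩
  simpa using hi

theorem randomDigraphProb_mono {n : ℕ} {p : unitInterval} {P Q : Digraph (Fin n) → Prop}
    (h : ∀ G, P G → Q G) : randomDigraphProb n p P ≤ randomDigraphProb n p Q :=
  MeasureTheory.measure_mono fun _ hE => h _ hE

theorem randomDigraphProb_exists_le {n : ℕ} {p : unitInterval} {ι : Type*} [Fintype ι]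
    (P : ι → Digraph (Fin n) → Prop) :
    randomDigraphProb n p (fun G => ∃ i, P i G) ≤ ∑ i, randomDigraphProb n p (P i) := by
  unfold randomDigraphProb
  have : {E : Set (Fin n × Fin n) | ∃ i, P i (ofEdgeSet E)} =
      ⋃ i, {E : Set (Fin n × Fin n) | P i (ofEdgeSet E)} := by
    ext; simp
  rw [this]
  exact MeasureTheory.measure_iUnion_fintype_le _ _

/-- Only subadditivity is used, so no measurability of the event is needed. -/
theorem almostSurely_of_tendsto_not {p : ℕ → unitInterval} {P : ∀ n : ℕ, Digraph (Fin n) → Prop}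
    (h : Tendsto (fun n => randomDigraphProb n (p n) fun G => ¬ P n G) atTop (𝓝 0)) :
    AlmostSurely p P := by
  unfold AlmostSurely
  have h1 := ENNReal.Tendsto.sub (tendsto_const_nhds (x := (1 : ENNReal)) (f := atTop (α := ℕ))) h
    (Or.inl ENNReal.one_ne_top)
  rw [tsub_zero] at h1
  refine tendsto_of_tendsto_of_tendsto_of_le_of_le h1 tendsto_const_nhds (fun n => ?_) fun n => ?_
  · rw [tsub_le_iff_right]
    unfold randomDigraphProb
    rw [← MeasureTheory.measure_univ (μ := setBer({e : Fin n × Fin n | e.1 ≠ e.2}, p n))]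
    refine le_trans (MeasureTheory.measure_mono fun E _ => ?_) (MeasureTheory.measure_union_le _ _)
    exact em (P n (ofEdgeSet E))
  · exact MeasureTheory.prob_le_one

/-- Below `δ / 4 * log n`, the union bound over all families of permutations is effective. -/
theorem randomDigraphProb_tau_lt_le {V : Type*} [Fintype V] {H : Digraph V} (hdag : IsDag H)
    (hiso : NoIsolatedVertices H) (hedges : 2 ≤ {e : V × V | H.Adj e.1 e.2}.ncard)
    (hstar : ¬ IsRootedStar H) {a δ : ℝ} (ha : fractionalArboricity H < a)
    (hδ : δ = 1 - fractionalArboricity H / a) (hδ0 : 0 < δ) {n : ℕ} (hn : 2 ≤ n)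
    (hn' : 2 * (Fintype.card V : ℝ) ^ 2 * (n : ℝ) ^ (δ / 4) ≤ n) :
    randomDigraphProb n (edgeProb a n)
        (fun G => ¬ δ / 4 * Real.logb 2 n ≤ (tau H G : ℝ)) ≤
      ENNReal.ofReal (Real.exp (n * (δ / 4 * Real.logb 2 n * Real.log n) -
        (n : ℝ) ^ (1 + δ / 2) / (16 * ((Fintype.card V : ℝ) + 1) ^ Fintype.card V))) := by
  have hn0 : (0 : ℝ) < n := by positivity
  have hn1 : (1 : ℝ) < n := by exact_mod_cast hn
  have hlogb : 0 < Real.logb 2 n := Real.logb_pos (by norm_num) hn1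
  have hlog : 0 < Real.log n := Real.log_pos hn1
  set x := δ / 4 * Real.logb 2 n with hx
  have hx0 : 0 < x := by positivity
  have hfl : (⌊x⌋₊ : ℝ) ≤ x := Nat.floor_le hx0.le
  have ht : (2 : ℝ) ^ ⌊x⌋₊ ≤ (n : ℝ) ^ (δ / 4) := by
    rw [← Real.rpow_natCast]
    refine (Real.rpow_le_rpow_of_exponent_le (by norm_num) hfl).trans ?_
    rw [hx, mul_comm, Real.rpow_mul (by norm_num), Real.rpow_logb (by norm_num) (by norm_num) hn0]
  have hsub : ∀ G : Digraph (Fin n), ¬ x ≤ (tau H G : ℝ) →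
      ∃ π : Fin ⌊x⌋₊ → Equiv.Perm (Fin n), CoversAllCopies H G π := by
    intro G hG
    obtain ⟨t, _, π, hπ⟩ := exists_coversAllCopies hdag hn
    exact tau_spec ⟨t, π, hπ G⟩ (Nat.le_floor (not_le.1 hG).le)
  refine (randomDigraphProb_mono hsub).trans ((randomDigraphProb_exists_le _).trans ?_)
  refine (Finset.sum_le_sum fun π _ => randomDigraphProb_covers_le hdag hiso hedges hstar ha hδ
    (by omega) ht hn' π).trans ?_
  rw [Finset.sum_const, Finset.card_univ, nsmul_eq_mul, Fintype.card_fun, Fintype.card_perm,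
    Fintype.card_fin, Fintype.card_fin, ← ENNReal.ofReal_natCast,
    ← ENNReal.ofReal_mul (Nat.cast_nonneg _), sub_eq_add_neg, Real.exp_add]
  refine ENNReal.ofReal_le_ofReal (mul_le_mul_of_nonneg_right ?_ (Real.exp_pos _).le)
  push_cast
  have h1 : (n.factorial : ℝ) ≤ Real.exp (n * Real.log n) := by
    rw [mul_comm, Real.exp_mul, Real.exp_log hn0, Real.rpow_natCast]
    exact_mod_cast Nat.factorial_le_pow n
  calc (n.factorial : ℝ) ^ ⌊x⌋₊ ≤ Real.exp (n * Real.log n) ^ ⌊x⌋₊ := by gcongr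
    _ = Real.exp (⌊x⌋₊ * (n * Real.log n)) := (Real.exp_nat_mul _ _).symm
    _ ≤ Real.exp (x * (n * Real.log n)) := by gcongr
    _ = _ := by ring_nf

/-- After factoring out `n^(1+δ/2)`, the positive part is a constant times `log² n / n^(δ/2)`, which
vanishes, and `-1/K` remains. -/
theorem tendsto_union_bound {δ K : ℝ} (hδ : 0 < δ) (hK : 0 < K) :
    Tendsto (fun n : ℕ => (n : ℝ) * (δ / 4 * Real.logb 2 n * Real.log n) -
      (n : ℝ) ^ (1 + δ / 2) / K) atTop atBot := by
  have h1 : Tendsto (fun x : ℝ => Real.log x ^ (2 : ℝ) / x ^ (δ / 2)) atTop (𝓝 0) :=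
    (isLittleO_log_rpow_rpow_atTop 2 (by positivity)).tendsto_div_nhds_zero
  have h2 : Tendsto (fun x : ℝ => x ^ (1 + δ / 2) *
      (δ / 4 / Real.log 2 * (Real.log x ^ (2 : ℝ) / x ^ (δ / 2)) - 1 / K)) atTop atBot := by
    refine (tendsto_rpow_atTop (by positivity)).atTop_mul_neg (C := -(1 / K))
      (by simpa using hK) ?_
    have := (h1.const_mul (δ / 4 / Real.log 2)).sub_const (1 / K)
    simpa using this
  refine (h2.comp tendsto_natCast_atTop_atTop).congr' ?_
  filter_upwards [eventually_gt_atTop 0] with n hn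
  have hn0 : (0 : ℝ) < n := by exact_mod_cast hn
  simp only [Function.comp_apply, Real.rpow_add hn0, Real.rpow_one, Real.logb, Real.rpow_ofNat]
  have : (n : ℝ) ^ (δ / 2) ≠ 0 := by positivity
  field_simp

theorem eventually_mul_rpow_le {δ : ℝ} (hδ1 : δ < 4) (M : ℝ) :
    ∀ᶠ n : ℕ in atTop, M * (n : ℝ) ^ (δ / 4) ≤ n := by
  have h1 : Tendsto (fun n : ℕ => (n : ℝ) ^ (1 - δ / 4)) atTop atTop :=
    (tendsto_rpow_atTop (by linarith)).comp tendsto_natCast_atTop_atTop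
  filter_upwards [h1.eventually_ge_atTop M, eventually_gt_atTop 0] with n hM hn
  have hn0 : (0 : ℝ) < n := by exact_mod_cast hn
  calc M * (n : ℝ) ^ (δ / 4) ≤ (n : ℝ) ^ (1 - δ / 4) * (n : ℝ) ^ (δ / 4) := by gcongr
    _ = n := by
      rw [← Real.rpow_add hn0, sub_add_cancel, Real.rpow_one]

theorem exists_pos_almostSurely_le_tau {V : Type*} [Fintype V] {H : Digraph V} (hdag : IsDag H)
    (hiso : NoIsolatedVertices H) (hedges : 2 ≤ {e : V × V | H.Adj e.1 e.2}.ncard)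
    (hstar : ¬ IsRootedStar H) {a : ℝ} (ha : fractionalArboricity H < a) :
    ∃ c : ℝ, 0 < c ∧ AlmostSurely (edgeProb a)
      fun n G => c * Real.logb 2 n ≤ (tau H G : ℝ) := by
  have hb0 : 0 < fractionalArboricity H := by
    refine fractionalArboricity_pos ?_ ?_
    · rintro a b h rfl
      exact hdag a (.single h)
    · rw [← Finset.card_pos, card_edges]
      omega
  have ha0 : 0 < a := hb0.trans ha
  obtain ⟨δ, hδ⟩ : ∃ δ, δ = 1 - fractionalArboricity H / a := ⟨_, rfl⟩
  have hδ0 : 0 < δ := by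
    rw [hδ, sub_pos]
    exact (div_lt_one ha0).2 ha
  have hδ1 : δ < 1 := by
    have := div_pos hb0 ha0
    linarith
  refine ⟨δ / 4, by positivity, almostSurely_of_tendsto_not ?_⟩
  have hK : (0 : ℝ) < 16 * ((Fintype.card V : ℝ) + 1) ^ Fintype.card V := by positivity
  have hlim := ENNReal.tendsto_ofReal (Real.tendsto_exp_atBot.comp (tendsto_union_bound hδ0 hK))
  rw [ENNReal.ofReal_zero] at hlim
  refine tendsto_of_tendsto_of_tendsto_of_le_of_le' tendsto_const_nhds hlim
    (Eventually.of_forall fun _ => zero_le) ?_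
  filter_upwards [eventually_ge_atTop 2,
    eventually_mul_rpow_le (δ := δ) (by linarith) (2 * (Fintype.card V : ℝ) ^ 2)] with n hn hn'
  exact randomDigraphProb_tau_lt_le hdag hiso hedges hstar ha hδ hδ0 hn hn'

end Asymptotics

end DagCover

theorem theorem1 {V : Type*} [Fintype V] (H : Digraph V)
    (hdag : DagCover.IsDag H)
    (hiso : DagCover.NoIsolatedVertices H)
    (hedges : 2 ≤ {e : V × V | H.Adj e.1 e.2}.ncard)
    (hstar : ¬ DagCover.IsRootedStar H)
    (a : ℝ) (ha : DagCover.fractionalArboricity H < a) :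
    ∃ c : ℝ, 0 < c ∧
      DagCover.AlmostSurely (DagCover.edgeProb a)
        (fun n G => c * Real.logb 2 n ≤ (DagCover.tau H G : ℝ)) ∧
      ∃ C : ℝ, 0 < C ∧
        DagCover.AlmostSurely (DagCover.edgeProb a)
          (fun n G => c * Real.logb 2 n ≤ (DagCover.tau H G : ℝ) ∧
            (DagCover.tau H G : ℝ) ≤ C * Real.logb 2 n) := by
  obtain ⟨c, hc, hlow⟩ := DagCover.exists_pos_almostSurely_le_tau hdag hiso hedges hstar ha
  refine ⟨c, hc, hlow, (Fintype.card V).factorial * Fintype.card V + 1, by positivity, ?_⟩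
  -- The upper bound holds for every digraph once `n ≥ 2`, so the two-sided event then coincides
  -- with the lower-bound event.
  refine Filter.Tendsto.congr' ?_ hlow
  filter_upwards [Filter.eventually_ge_atTop 2] with n hn
  refine congrArg (DagCover.randomDigraphProb n _) (funext fun G => propext ?_)
  obtain ⟨t, ht, π, hπ⟩ := DagCover.exists_coversAllCopies hdag hn
  have hle : DagCover.tau H G ≤ t := Nat.sInf_le ⟨π, hπ G⟩
  have hle' : (DagCover.tau H G : ℝ) ≤ t := by exact_mod_cast hle
  exact ⟨fun h => ⟨h, hle'.trans ht⟩, fun h => h.1⟩
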